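/- Let $\mathcal O$ be a discrete valuation ring with uniformizer $\pi$ and residue field $k$ of characteristic $\neq 2$ (for example the ring of integers of the completion of the maximal unramified extension of a finite extension of $\mathbb Q_p$, $p$ odd). Let $d=2n\ge 5$ and $l=2r$ with $l>1$ and $d-l>1$, so $n\ge 3$ and $1\le r\le n-1$. Let $Z=\{n-r+1,\dots,n+r\}$ and $Z^c=\{1,\dots,d\}\setminus Z$. Write the generic $d\times d$ matrix $X=(x_{i,j})$ in blocks $$X=\begin{pmatrix}E_1&O_1&E_2\\ B_1&A&B_2\\ E_3&O_2&E_4\end{pmatrix}$$ with rows and columns of sizes $n-r,\,2r,\,n-r$. Let $J_m$ be the $m\times m$ unit antidiagonal matrix, and let $S_0$, $S_1$ be the $d\times d$ antidiagonal matrices with antidiagonal entries $1^{(n-r)},0^{(2r)},1^{(n-r)}$ and $0^{(n-r)},1^{(2r)},0^{(n-r)}$ respectively. Let $I\subset\mathcal O[X]$ be the ideal generated by the $2\times2$ minors of $X$, by $\mathrm{Tr}(X)$, by $\mathrm{Tr}(A)+2\pi$, and by the entries of $$X^2,\quad X^tS_0X-2\pi(S_0X+\pi S_1X),\quad X^tS_1X+2(S_0X+\pi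 S_1X),\quad AJ_{2r}-J_{2r}A^t,\quad B_2J_{n-r}B_1^t-AJ_{2r}.$$ Put $U_{d,l}=\mathrm{Spec}(\mathcal O[X]/I)$, and let $\overline U_{d,l}=\mathrm{Spec}(k\otimes_{\mathcal O}\mathcal O[X]/I)$ be its special fiber. Let $k[B_1|B_2]=k[x_{t,s}]_{t\in Z,\,s\in Z^c}$, and let $\wedge^2(B_1|B_2)$ denote the set of $2\times 2$ minors of the matrix $(B_1|B_2)=(x_{t,s})_{t\in Z,\,s\in Z^c}$. (i) If $r=1$ or $r=n-1$, then $\overline U_{d,l}$ has exactly three irreducible components. (ii) If $1<r<n-1$, then $\overline U_{d,l}$ has exactly two irreducible components. Moreover, the natural map from $k[B_1|B_2]$ to the coordinate ring of $\overline U_{d,l}$ is surjective, so that $\overline U_{d,l}$ is a closed subscheme of $\mathrm{Spec}\,k[B_1|B_2]$, and its irreducible components are exactly the pairwise distinct closed subschemes $V(I_c)$ of $\overline U_{d,l}$ for the following ideals $I_c$ of $k[B_1|B_2]$. Each $I_c$ is prime, and each $V(I_c)$ has dimension $d-2$. * If $r=1$: $I_1=\big((x_{n,j})_{j\in Z^c}\big)$,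 $I_2=\big((x_{n+1,j})_{j\in Z^c}\big)$, and $$I_3=\Big(\sum_{a=1}^{n-1}x_{n,a}x_{n,d+1-a},\ \sum_{a=1}^{n-1}x_{n+1,a}x_{n+1,d+1-a},\ \sum_{a=1}^{n-1}x_{n,a}x_{n+1,d+1-a},\ \wedge^2(B_1|B_2)\Big).$$ * If $r=n-1$: $I_1=\big((x_{i,1})_{i\in Z}\big)$, $I_2=\big((x_{i,d})_{i\in Z}\big)$, and $$I_3=\Big(\sum_{a=2}^{n}x_{a,1}x_{d+1-a,1},\ \sum_{a=2}^{n}x_{a,d}x_{d+1-a,d},\ \sum_{a=2}^{n}x_{a,1}x_{d+1-a,d},\ \wedge^2(B_1|B_2)\Big).$$ * If $1<r<n-1$: $$I_1=\Big(\Big(\sum_{a=n-r+1}^{n}x_{d+1-a,d+1-t}\,x_{a,s}\Big)_{t,s\in Z^c},\ \wedge^2(B_1|B_2)\Big),\quad I_2=\Big(\Big(\sum_{a=1}^{n-r}x_{i,a}\,x_{d+1-j,d+1-a}\Big)_{i,j\in Z},\ \wedge^2(B_1|B_2)\Big).$$ -/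

import Mathlib

open scoped TensorProduct

noncomputable section

namespace OrthogonalChart

/-! ### Index sets

Rows and columns are indexed by `Fin (2 * n)`, so the classical index `i ∈ {1, …, d}` (`d = 2n`)
is the element of value `i - 1`, and `i ↦ d + 1 - i` is `Fin.rev`. -/

/-- `Z = {n - r + 1, …, n + r}`, the middle block of indices (of size `l = 2r`). -/
def Z (n r : ℕ) : Finset (Fin (2 * n)) :=
  Finset.univ.filter fun i => n ≤ (i : ℕ) + r ∧ (i : ℕ) < n + r

/-- `Zᶜ = {1, …, n - r} ∪ {n + r + 1, …, d}`. -/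
def Zc (n r : ℕ) : Finset (Fin (2 * n)) := (Z n r)ᶜ

/-- The first block of indices `{1, …, n - r}`. -/
def lo (n r : ℕ) : Finset (Fin (2 * n)) := Finset.univ.filter fun i => (i : ℕ) + r < n

/-- The last block of indices `{n + r + 1, …, d}`. -/
def hi (n r : ℕ) : Finset (Fin (2 * n)) := Finset.univ.filter fun i => n + r ≤ (i : ℕ)

theorem rev_mem_Z {n r : ℕ} {i : Fin (2 * n)} (h : i ∈ Z n r) : i.rev ∈ Z n r := by
  simp only [Z, Finset.mem_filter, Finset.mem_univ, true_and, Fin.val_rev] at *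
  omega

theorem rev_mem_Zc {n r : ℕ} {i : Fin (2 * n)} (h : i ∈ Zc n r) : i.rev ∈ Zc n r := by
  simp only [Zc, Finset.mem_compl] at *
  intro h'
  exact h (by simpa using rev_mem_Z h')

/-- `i ↦ d + 1 - i` on `Z`. -/
def revZ {n r : ℕ} (i : Z n r) : Z n r := ⟨i.1.rev, rev_mem_Z i.2⟩

/-- `i ↦ d + 1 - i` on `Zᶜ`. -/
def revZc {n r : ℕ} (i : Zc n r) : Zc n r := ⟨i.1.rev, rev_mem_Zc i.2⟩

/-! ### Matrices -/

/-- The entries of a matrix. -/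
def entries {R α β : Type*} (M : Matrix α β R) : Set R := {f | ∃ i j, f = M i j}

/-- The `2 × 2` minors of a matrix. -/
def minors {R α β : Type*} [CommRing R] (M : Matrix α β R) : Set R :=
  {f | ∃ i t j s, f = M i j * M t s - M i s * M t j}

/-- The block of `M` with rows in `s` and columns in `t`. -/
def block {R α : Type*} (M : Matrix α α R) (s t : Finset α) : Matrix s t R :=
  M.submatrix Subtype.val Subtype.val

/-- The unit antidiagonal matrix. -/
def J (R : Type*) [CommRing R] (m : ℕ) : Matrix (Fin m) (Fin m) R :=
  Matrix.of fun i j => if i = j.rev then 1 else 0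

/-- The antidiagonal matrix with antidiagonal entries `1^(n-r), 0^(2r), 1^(n-r)`. -/
def S₀ (R : Type*) [CommRing R] (n r : ℕ) : Matrix (Fin (2 * n)) (Fin (2 * n)) R :=
  Matrix.of fun i j => if i = j.rev ∧ i ∉ Z n r then 1 else 0

/-- The antidiagonal matrix with antidiagonal entries `0^(n-r), 1^(2r), 0^(n-r)`. -/
def S₁ (R : Type*) [CommRing R] (n r : ℕ) : Matrix (Fin (2 * n)) (Fin (2 * n)) R :=
  Matrix.of fun i j => if i = j.rev ∧ i ∈ Z n r then 1 else 0

/-! ### The chart `U_{d,l}` for `d = 2n`, `l = 2r` -/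

section Chart

variable {O : Type*} [CommRing O]

/-- `O[X]`, the polynomial ring in the entries of a `d × d` matrix. -/
abbrev PolyX (O : Type*) [CommRing O] (n : ℕ) : Type _ :=
  MvPolynomial (Fin (2 * n) × Fin (2 * n)) O

/-- The generic `d × d` matrix `X`. -/
def genX (O : Type*) [CommRing O] (n : ℕ) : Matrix (Fin (2 * n)) (Fin (2 * n)) (PolyX O n) :=
  Matrix.of fun i j => MvPolynomial.X (i, j)

/-- The block `A` of `X`. -/
def blockA (O : Type*) [CommRing O] (n r : ℕ) : Matrix (Z n r) (Z n r) (PolyX O n) :=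
  block (genX O n) (Z n r) (Z n r)

/-- The block `B₁` of `X`. -/
def blockB₁ (O : Type*) [CommRing O] (n r : ℕ) : Matrix (Z n r) (lo n r) (PolyX O n) :=
  block (genX O n) (Z n r) (lo n r)

/-- The block `B₂` of `X`. -/
def blockB₂ (O : Type*) [CommRing O] (n r : ℕ) : Matrix (Z n r) (hi n r) (PolyX O n) :=
  block (genX O n) (Z n r) (hi n r)

/-- `J_{2r}`, as the `Z × Z` block of `J_{2n}`. -/
def Jmid (R : Type*) [CommRing R] (n r : ℕ) : Matrix (Z n r) (Z n r) R :=
  block (J R (2 * n)) (Z n r) (Z n r)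

/-- `J_{n-r}`, as the lower left block of `J_{2n}`: rows are indexed by the columns
of `B₂`, columns by the columns of `B₁`. -/
def Jout (R : Type*) [CommRing R] (n r : ℕ) : Matrix (hi n r) (lo n r) R :=
  block (J R (2 * n)) (hi n r) (lo n r)

/-- `I^naive`, generated by the entries of `X²`, the `2 × 2` minors of `X` and the entries of
`Xᵗ S₀ X - 2π (S₀ X + π S₁ X)` and `Xᵗ S₁ X + 2 (S₀ X + π S₁ X)`. -/
def idealNaive (π : O) (n r : ℕ) : Ideal (PolyX O n) :=
  let X := genX O n
  let S0 := S₀ (PolyX O n) n r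
  let S1 := S₁ (PolyX O n) n r
  Ideal.span
    (entries (X * X) ∪ minors X ∪
      entries (X.transpose * S0 * X - (2 * π) • (S0 * X + π • (S1 * X))) ∪
      entries (X.transpose * S1 * X + (2 : O) • (S0 * X + π • (S1 * X))))

/-- `I^add = (Tr X, Tr A + 2π, A J_{2r} - J_{2r} Aᵗ, B₂ J_{n-r} B₁ᵗ - A J_{2r})`. -/
def idealAdd (π : O) (n r : ℕ) : Ideal (PolyX O n) :=
  let A := blockA O n r
  let Jl := Jmid (PolyX O n) n r
  Ideal.span
    ({(genX O n).trace, A.trace + MvPolynomial.C (2 * π)} ∪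
      entries (A * Jl - Jl * A.transpose) ∪
      entries (blockB₂ O n r * Jout (PolyX O n) n r * (blockB₁ O n r).transpose - A * Jl))

/-- The coordinate ring `O[X] / (I^naive + I^add)` of the chart `U_{d,l}`. -/
abbrev ChartRing (π : O) (n r : ℕ) : Type _ :=
  PolyX O n ⧸ (idealNaive π n r ⊔ idealAdd π n r)

variable [IsLocalRing O]

/-- The coordinate ring `k ⊗_O O[X]/I` of the special fiber of `U_{d,l}`. -/
abbrev SpecialFiberRing (π : O) (n r : ℕ) : Type _ :=
  IsLocalRing.ResidueField O ⊗[O] ChartRing π n r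

/-- The special fiber of `U_{d,l}`. -/
abbrev SpecialFiber (π : O) (n r : ℕ) : Type _ := PrimeSpectrum (SpecialFiberRing π n r)

end Chart

/-! ### Ideals in the entries of `(B₁ | B₂)` -/

section Components

/-- `k[B₁|B₂]`, the polynomial ring in the `x_{t,s}` with `t ∈ Z`, `s ∈ Zᶜ`. -/
abbrev PolyB (k : Type*) [CommRing k] (n r : ℕ) : Type _ := MvPolynomial (Z n r × Zc n r) k

variable (k : Type*) [CommRing k] (n r : ℕ)

/-- The generic matrix `(B₁ | B₂)`. -/
def genB : Matrix (Z n r) (Zc n r) (PolyB k n r) := Matrix.of fun i j => MvPolynomial.X (i, j)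

/-- Case `1 < r < n - 1`, first component: generated by
`∑_{a=n-r+1}^{n} x_{d+1-a,d+1-t} x_{a,s}` for `t, s ∈ Zᶜ` and the `2 × 2` minors. -/
def idealMid₁ : Ideal (PolyB k n r) :=
  let x := genB k n r
  Ideal.span
    ({f | ∃ t s, f = ∑ a : Z n r with (a.1 : ℕ) < n, x (revZ a) (revZc t) * x a s} ∪ minors x)

/-- Case `1 < r < n - 1`, second component: generated by
`∑_{a=1}^{n-r} x_{i,a} x_{d+1-j,d+1-a}` for `i, j ∈ Z` and the `2 × 2` minors. -/
def idealMid₂ : Ideal (PolyB k n r) :=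
  let x := genB k n r
  Ideal.span
    ({f | ∃ i j, f = ∑ a : Zc n r with (a.1 : ℕ) < n, x i a * x (revZ j) (revZc a)} ∪ minors x)

/-- Case `r = 1` (so `Z = {n, n+1}`), first component: generated by row `n`. -/
def idealLow₁ : Ideal (PolyB k n r) :=
  Ideal.span {f | ∃ (i : Z n r) (j : Zc n r), (i.1 : ℕ) + 1 = n ∧ f = genB k n r i j}

/-- Case `r = 1`, second component: generated by row `n + 1`. -/
def idealLow₂ : Ideal (PolyB k n r) :=
  Ideal.span {f | ∃ (i : Z n r) (j : Zc n r), (i.1 : ℕ) = n ∧ f = genB k n r i j}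

/-- Case `r = 1`, third component: generated by the three sums
`∑_{a=1}^{n-1} x_{i,a} x_{j,d+1-a}` for `(i, j) = (n, n), (n, n+1), (n+1, n+1)`
and the `2 × 2` minors. -/
def idealLow₃ : Ideal (PolyB k n r) :=
  let x := genB k n r
  Ideal.span
    ({f | ∃ i j : Z n r, i ≤ j ∧
      f = ∑ a : Zc n r with (a.1 : ℕ) < n, x i a * x j (revZc a)} ∪ minors x)

/-- Case `r = n - 1` (so `Zᶜ = {1, d}`), first component: generated by column `1`. -/
def idealHigh₁ : Ideal (PolyB k n r) :=
  Ideal.span {f | ∃ (i : Z n r) (j : Zc n r), (j.1 : ℕ) = 0 ∧ f = genB k n r i j}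

/-- Case `r = n - 1`, second component: generated by column `d`. -/
def idealHigh₂ : Ideal (PolyB k n r) :=
  Ideal.span {f | ∃ (i : Z n r) (j : Zc n r), (j.1 : ℕ) + 1 = 2 * n ∧ f = genB k n r i j}

/-- Case `r = n - 1`, third component: generated by the three sums
`∑_{a=2}^{n} x_{a,s} x_{d+1-a,t}` for `(s, t) = (1, 1), (1, d), (d, d)`
and the `2 × 2` minors. -/
def idealHigh₃ : Ideal (PolyB k n r) :=
  let x := genB k n r
  Ideal.span
    ({f | ∃ s t : Zc n r, s ≤ t ∧
      f = ∑ a : Z n r with (a.1 : ℕ) < n, x a s * x (revZ a) t} ∪ minors x)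

end Components

section Description

variable {O : Type*} [CommRing O] [IsLocalRing O]

/-- The `k`-algebra homomorphism from `k[B₁|B₂]` to the coordinate ring of the special fiber that
sends `x_{t,s}` to the class of the entry `x_{t,s}` of `X`. -/
def fromB (π : O) (n r : ℕ) :
    PolyB (IsLocalRing.ResidueField O) n r →ₐ[IsLocalRing.ResidueField O]
      SpecialFiberRing π n r :=
  MvPolynomial.aeval fun p : Z n r × Zc n r =>
    (1 : IsLocalRing.ResidueField O) ⊗ₜ[O] Ideal.Quotient.mk (idealNaive π n r ⊔ idealAdd π n r) (genX O n p.1 p.2)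

/-- The closed subset of the special fiber cut out by the equations in an ideal of `k[B₁|B₂]`. -/
def locus (π : O) (n r : ℕ) (I : Ideal (PolyB (IsLocalRing.ResidueField O) n r)) :
    Set (SpecialFiber π n r) :=
  PrimeSpectrum.zeroLocus (fromB π n r '' (I : Set (PolyB (IsLocalRing.ResidueField O) n r)))

/-- The ideals `I₁, …, I_m` of `k[B₁|B₂]` define the irreducible components of the special fiber:
the entries of `(B₁|B₂)` embed the special fiber as a closed subscheme of `Spec k[B₁|B₂]` which
contains every `V(I_c)` as a closed subscheme, the `V(I_c)` are pairwise distinct, they are exactly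
the irreducible components, each has dimension `d - 2`, and each `I_c` is prime. -/
structure DefineComponents (π : O) (n r : ℕ) {m : ℕ}
    (I : Fin m → Ideal (PolyB (IsLocalRing.ResidueField O) n r)) : Prop where
  surjective : Function.Surjective (fromB π n r)
  ker_le : ∀ c, RingHom.ker (fromB π n r) ≤ I c
  injective : Function.Injective fun c => locus π n r (I c)
  range_eq : Set.range (fun c => locus π n r (I c)) = irreducibleComponents (SpecialFiber π n r)
  dim_eq : ∀ c, topologicalKrullDim (locus π n r (I c)) = ((2 * n - 2 : ℕ) : WithBot ℕ∞)
  isPrime : ∀ c, (I c).IsPrime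

end Description

end OrthogonalChart

end

/-! Modulo π the chart becomes a space of rank one matrices. The relation `middle` expresses A
through B₁ and B₂, and `form₁` together with the invertibility of 2 expresses the remaining rows
through A, B₁, B₂. Hence `fromB` is surjective (`fromB_surjective`), and everything happens in the
matrix B = (B₁|B₂).

Let q be the split quadratic form ∑ u_a u_{d+1-a} over the lower half of Z, and q' the analogous
form on Zᶜ. The minors of B vanish on the fiber, and Tr A = 0, rewritten through `middle`, says that
every equation of q on the columns of B times every equation of q' on the rows of B vanishes
(`IsFiberPoint.quad_mul_quad`). Conversely, u vᵗ with q(u) q'(v) = 0 extends to an explicit point of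
the fiber over any k-algebra (`isFiberPoint_rankOne`). So the fiber is, up to nilpotents, the locus
of B = u vᵗ with q(u) = 0 or q'(v) = 0. The kernel of `fromB` is never computed: it suffices that it
contains the minors and these products, and that it lies in each I_c.

The ideal of the locus q(u) = 0 is the preimage of (q) under the Segre map x_{ij} ↦ u_i v_j
(`comap_segre_eq_quadIdeal`). When q has at least two hyperbolic planes it is an irreducible
polynomial, so this preimage is prime, and a transcendence basis gives its dimension |Z| + |Zᶜ| - 2
= d - 2. When q or q' has a single hyperbolic plane (r = 1 or r = n - 1), it is a product of two
variables; that locus splits into the loci where one row or one column of B vanishes, again of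
dimension d - 2, which gives three components instead of two. Explicit rank one matrices over k show
that the primes are pairwise incomparable, hence they are the minimal primes. -/

noncomputable section

namespace OrthogonalChart

/-! ### Krull dimension of finitely generated domains -/

section KrullDim

/-- An injective integral extension preserves the Krull dimension. -/
theorem ringKrullDim_eq_of_isIntegral {R S : Type*} [CommRing R] [CommRing S] [Algebra R S]
    [Algebra.IsIntegral R S] (h : Function.Injective (algebraMap R S)) :
    ringKrullDim S = ringKrullDim R := by
  apply le_antisymm
  -- Incomparability: contraction of primes is strictly monotone along an integral extension.
  · refine Order.krullDim_le_of_strictMono (PrimeSpectrum.comap (algebraMap R S)) ?_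
    intro p q hpq
    exact Ideal.IsIntegral.comap_lt_comap (I := p.asIdeal) (J := q.asIdeal) hpq
  -- Lying over at the bottom of the chain, then going up along it, lifts the chain to `S`.
  · refine iSup_le fun l => ?_
    have : FaithfulSMul R S := (faithfulSMul_iff_algebraMap_injective R S).2 h
    obtain ⟨P, -, hP, hPl⟩ := Ideal.exists_ideal_over_prime_of_isIntegral
      (S := S) (RelSeries.head l).asIdeal ⊥ (by
        rw [← RingHom.ker, (RingHom.injective_iff_ker_eq_bot _).1 h]; exact bot_le)
    have : P.LiesOver (RelSeries.head l).asIdeal := ⟨hPl.symm⟩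
    obtain ⟨M, hM, -⟩ := Ideal.exists_ltSeries_of_hasGoingUp (S := S) l P
    rw [← hM]
    exact le_iSup (fun p : LTSeries (PrimeSpectrum S) => ((p.length : ℕ∞) : WithBot ℕ∞)) M

/-- The Krull dimension of a finitely generated domain over a field is the cardinality of a
transcendence basis. -/
theorem ringKrullDim_eq_card_of_isTranscendenceBasis {k D ι : Type*} [Field k] [CommRing D]
    [IsDomain D] [Algebra k D] [Algebra.FiniteType k D] [Finite ι] {x : ι → D}
    (hx : IsTranscendenceBasis k x) : ringKrullDim D = Nat.card ι := by
  -- Noether normalization. The `s` variables form a second transcendence basis, and any two have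
  -- the same cardinality.
  obtain ⟨s, g, hg, hint⟩ := exists_integral_inj_algHom_of_fg k D
  let _ : Algebra (MvPolynomial (Fin s) k) D := g.toRingHom.toAlgebra
  have : IsScalarTower k (MvPolynomial (Fin s) k) D :=
    IsScalarTower.of_algebraMap_eq fun c => (g.commutes c).symm
  have hI : Algebra.IsIntegral (MvPolynomial (Fin s) k) D := ⟨hint⟩
  rw [ringKrullDim_eq_of_isIntegral (R := MvPolynomial (Fin s) k) hg,
    MvPolynomial.ringKrullDim_of_isNoetherianRing, ringKrullDim_eq_zero_of_field, zero_add]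
  have hf : FaithfulSMul (MvPolynomial (Fin s) k) D :=
    (faithfulSMul_iff_algebraMap_injective _ _).2 hg
  have hb : IsTranscendenceBasis k (algebraMap (MvPolynomial (Fin s) k) D ∘ MvPolynomial.X) :=
    (IsTranscendenceBasis.mvPolynomial (Fin s) k).algebraMap_comp
  have := hx.lift_cardinalMk_eq hb
  have h2 := congrArg Cardinal.toNat this
  simp only [Cardinal.toNat_lift] at h2
  have h3 : Nat.card ι = Nat.card (Fin s) := h2
  rw [h3]

end KrullDim

/-! ### Rank one matrices whose row vector lies on a split quadric -/

section Segre

open MvPolynomial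

/-- If the `2 × 2` minors of `y` vanish, a product of entries of `y` depends only on the row and
column indices, with multiplicity. -/
theorem prod_eq_of_marginals {α β R : Type*} [CommRing R] (y : α × β → R)
    (hy : ∀ i i' j j', y (i, j) * y (i', j') = y (i, j') * y (i', j)) (s t : Multiset (α × β))
    (h₁ : s.map Prod.fst = t.map Prod.fst) (h₂ : s.map Prod.snd = t.map Prod.snd) :
    (s.map y).prod = (t.map y).prod := by
  induction s using Multiset.induction generalizing t with
  | empty =>
    have : t = 0 := by simpa using h₁.symm
    simp [this]
  | cons p s ih =>
    obtain ⟨i, j⟩ := p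
    have hi : i ∈ t.map Prod.fst := by rw [← h₁]; simp
    obtain ⟨⟨i₀, j'⟩, hij', rfl⟩ := Multiset.mem_map.1 hi
    obtain ⟨t₁, rfl⟩ := Multiset.exists_cons_of_mem hij'
    by_cases hj : j' = j
    · subst hj
      simp only [Multiset.map_cons, Multiset.cons_inj_right, Multiset.prod_cons] at *
      rw [ih t₁ h₁ h₂]
    -- The column `j` occurs elsewhere in `t`, in a pair (i', j). One minor relation exchanges the
    -- columns of the two pairs, after which the pair to be cancelled is present on both sides.
    · have hj2 : j ∈ t₁.map Prod.snd := by
        have : j ∈ (((i₀, j') ::ₘ t₁).map Prod.snd) := by rw [← h₂]; simp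
        rw [Multiset.map_cons, Multiset.mem_cons] at this
        exact this.resolve_left fun h => hj h.symm
      obtain ⟨⟨i', j₀⟩, hij, rfl⟩ := Multiset.mem_map.1 hj2
      obtain ⟨t₂, rfl⟩ := Multiset.exists_cons_of_mem hij
      simp only [Multiset.map_cons, Multiset.cons_inj_right, Multiset.prod_cons] at *
      rw [Multiset.cons_swap, Multiset.cons_inj_right] at h₂
      rw [ih ((i', j') ::ₘ t₂) (by simpa using h₁) (by simpa using h₂), Multiset.map_cons,
        Multiset.prod_cons, ← mul_assoc, ← mul_assoc, hy]

/-- The exponent of the monomial `∏ uᵢ vⱼ`, the product running over the pairs in `s`. -/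
def pairExponent {α β : Type*} (s : Multiset (α × β)) : α ⊕ β →₀ ℕ :=
  (s.map fun p => Finsupp.single (Sum.inl p.1) 1 + Finsupp.single (Sum.inr p.2) 1).sum

@[simp]
theorem pairExponent_zero {α β : Type*} : pairExponent (0 : Multiset (α × β)) = 0 := by
  simp [pairExponent]

@[simp]
theorem pairExponent_cons {α β : Type*} (p : α × β) (s : Multiset (α × β)) :
    pairExponent (p ::ₘ s) =
      Finsupp.single (Sum.inl p.1) 1 + Finsupp.single (Sum.inr p.2) 1 + pairExponent s := by
  simp [pairExponent]

theorem pairExponent_inl {α β : Type*} [DecidableEq α] (s : Multiset (α × β)) (i : α) :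
    pairExponent s (Sum.inl i) = (s.map Prod.fst).count i := by
  induction s using Multiset.induction with
  | empty => simp
  | cons p s ih =>
    simp only [pairExponent_cons, Finsupp.add_apply, ih, Multiset.map_cons, Multiset.count_cons]
    by_cases h : i = p.1 <;> simp [h, add_comm]

theorem pairExponent_inr {α β : Type*} [DecidableEq β] (s : Multiset (α × β)) (j : β) :
    pairExponent s (Sum.inr j) = (s.map Prod.snd).count j := by
  induction s using Multiset.induction with
  | empty => simp
  | cons p s ih =>
    simp only [pairExponent_cons, Finsupp.add_apply, ih, Multiset.map_cons, Multiset.count_cons]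
    by_cases h : j = p.2 <;> simp [h, add_comm]

theorem prod_eq_of_pairExponent_eq {α β R : Type*} [CommRing R] (y : α × β → R)
    (hy : ∀ i i' j j', y (i, j) * y (i', j') = y (i, j') * y (i', j)) (s t : Multiset (α × β))
    (h : pairExponent s = pairExponent t) : (s.map y).prod = (t.map y).prod := by
  classical
  refine prod_eq_of_marginals y hy s t (Multiset.ext.2 fun i => ?_) (Multiset.ext.2 fun j => ?_)
  · rw [← pairExponent_inl, ← pairExponent_inl, h]
  · rw [← pairExponent_inr, ← pairExponent_inr, h]

variable (k : Type*) [Field k] {α β σ : Type*}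

/-- The linear map sending the monomial `∏ uᵢ vⱼ` to `∏ y (i, j)`, and the monomials not of this
form to `0`. -/
def unsegre {R : Type*} [CommRing R] [Algebra k R] (y : α × β → R) :
    MvPolynomial (α ⊕ β) k →ₗ[k] R :=
  open Classical in
  (basisMonomials (α ⊕ β) k).constr k fun m =>
    if h : ∃ s : Multiset (α × β), pairExponent s = m then (h.choose.map y).prod else 0

theorem unsegre_pairExponent {R : Type*} [CommRing R] [Algebra k R] (y : α × β → R)
    (hy : ∀ i i' j j', y (i, j) * y (i', j') = y (i, j') * y (i', j)) (s : Multiset (α × β)) :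
    unsegre k y (monomial (pairExponent s) 1) = (s.map y).prod := by
  have := (basisMonomials (α ⊕ β) k).constr_basis k (fun m =>
    open Classical in
    if h : ∃ s : Multiset (α × β), pairExponent s = m then (h.choose.map y).prod else 0)
    (pairExponent s)
  rw [coe_basisMonomials] at this
  have h : ∃ t : Multiset (α × β), pairExponent t = pairExponent s := ⟨s, rfl⟩
  rw [unsegre, this, dif_pos h]
  exact prod_eq_of_pairExponent_eq y hy _ _ h.choose_spec

theorem unsegre_of_not_exists {R : Type*} [CommRing R] [Algebra k R] (y : α × β → R)
    (m : α ⊕ β →₀ ℕ) (h : ¬ ∃ s : Multiset (α × β), pairExponent s = m) :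
    unsegre k y (monomial m 1) = 0 := by
  have := (basisMonomials (α ⊕ β) k).constr_basis k (fun m =>
    open Classical in
    if h : ∃ s : Multiset (α × β), pairExponent s = m then (h.choose.map y).prod else 0) m
  rw [coe_basisMonomials] at this
  rw [unsegre, this, dif_neg h]

/-- The generic `α × β` matrix, with entries the variables indexed by `σ ≃ α × β`. -/
def genericMatrix (e : α × β ≃ σ) : Matrix α β (MvPolynomial σ k) :=
  Matrix.of fun i j => X (e (i, j))

/-- The Segre map `x_{ij} ↦ uᵢ vⱼ`. -/
def segre (e : α × β ≃ σ) : MvPolynomial σ k →ₐ[k] MvPolynomial (α ⊕ β) k :=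
  aeval fun c => X (Sum.inl (e.symm c).1) * X (Sum.inr (e.symm c).2)

/-- The quadratic form `∑_{a ∈ L} u_a u_{τ a}`. -/
def quadForm {R : Type*} [CommRing R] (L : Finset α) (τ : α → α) (u : α → R) : R :=
  ∑ a ∈ L, u a * u (τ a)

/-- The ideal of matrices of rank at most one, all of whose columns are isotropic for
`quadForm L τ`, and orthogonal to each other. -/
def quadIdeal {R : Type*} [CommRing R] (x : Matrix α β R) (L : Finset α) (τ : α → α) : Ideal R :=
  Ideal.span ({f | ∃ s t, f = ∑ a ∈ L, x a s * x (τ a) t} ∪ minors x)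

/-- The polynomial `∑_{a ∈ L} u_a u_{τ a}` in the variables `u`, `v`. -/
def quadPoly (β : Type*) (L : Finset α) (τ : α → α) : MvPolynomial (α ⊕ β) k :=
  quadForm L τ fun a => X (Sum.inl a)

variable {k}

@[simp]
theorem segre_X (e : α × β ≃ σ) (p : α × β) :
    segre k e (X (e p)) = X (Sum.inl p.1) * X (Sum.inr p.2) := by
  simp [segre]

theorem segre_genericMatrix (e : α × β ≃ σ) (i : α) (j : β) :
    segre k e (genericMatrix k e i j) = X (Sum.inl i) * X (Sum.inr j) := by
  simp [genericMatrix]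

theorem segre_prod (e : α × β ≃ σ) (s : Multiset (α × β)) :
    segre k e ((s.map fun p => X (e p)).prod) = monomial (pairExponent s) 1 := by
  induction s using Multiset.induction with
  | empty => simp
  | cons p s ih =>
    rw [Multiset.map_cons, Multiset.prod_cons, map_mul, ih, segre_X, pairExponent_cons, X, X,
      monomial_mul, monomial_mul]
    simp

theorem quadIdeal_le_comap (e : α × β ≃ σ) (L : Finset α) (τ : α → α) :
    quadIdeal (genericMatrix k e) L τ ≤ (Ideal.span {quadPoly k β L τ}).comap (segre k e) := by
  refine Ideal.span_le.2 ?_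
  rintro f (⟨s, t, rfl⟩ | ⟨i, t, j, s, rfl⟩)
  · refine Ideal.mem_span_singleton.2 ⟨X (Sum.inr s) * X (Sum.inr t), ?_⟩
    simp only [map_sum, map_mul, segre_genericMatrix, quadPoly, quadForm, Finset.sum_mul]
    exact Finset.sum_congr rfl fun a _ => by ring
  · refine Ideal.mem_comap.2 ?_
    have : segre k e (genericMatrix k e i j * genericMatrix k e t s -
        genericMatrix k e i s * genericMatrix k e t j) = 0 := by
      simp only [map_sub, map_mul, segre_genericMatrix]; ring
    rw [this]; exact zero_mem _

/-- Every monomial in the entries maps to a balanced monomial ∏ u_i v_j, from which `unsegre`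
recovers its value under `f`. Thus `unsegre` inverts the Segre map modulo the minors. -/
theorem unsegre_segre {R : Type*} [CommRing R] [Algebra k R] (e : α × β ≃ σ)
    (f : MvPolynomial σ k →ₐ[k] R)
    (hf : ∀ i i' j j', f (X (e (i, j))) * f (X (e (i', j'))) =
      f (X (e (i, j'))) * f (X (e (i', j))))
    (p : MvPolynomial σ k) : unsegre k (fun p => f (X (e p))) (segre k e p) = f p := by
  suffices (unsegre k fun p => f (X (e p))) ∘ₗ (segre k e).toLinearMap = f.toLinearMap from
    LinearMap.congr_fun this p
  refine (basisMonomials σ k).ext fun m => ?_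
  obtain ⟨s, hs⟩ : ∃ s : Multiset (α × β),
      monomial m (1 : k) = (s.map fun p => X (e p)).prod := by
    -- The variables of `m`, listed with multiplicity and read as pairs.
    refine ⟨(Finsupp.toMultiset m).map e.symm, ?_⟩
    rw [Multiset.map_map]
    simp only [Function.comp_def, Equiv.apply_symm_apply]
    rw [Finsupp.toMultiset_map, Finsupp.prod_toMultiset, monomial_eq]
    rw [Finsupp.prod_mapDomain_index] <;> simp [pow_add]
  rw [coe_basisMonomials]
  beta_reduce
  rw [hs, LinearMap.comp_apply, AlgHom.toLinearMap_apply, segre_prod,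
    unsegre_pairExponent k _ hf, AlgHom.toLinearMap_apply, map_multiset_prod, Multiset.map_map]
  rfl

/-- On a monomial m, either no term u_a u_{τ a} m is balanced and all are sent to 0, or one is; then
the columns paired with a and τ a serve for all terms, and the sum is a multiple of a relation in
`hL`. -/
theorem unsegre_quadPoly_mul {R : Type*} [CommRing R] [Algebra k R] (y : α × β → R)
    (hy : ∀ i i' j j', y (i, j) * y (i', j') = y (i, j') * y (i', j))
    (L : Finset α) (τ : α → α) (hL : ∀ s t, ∑ a ∈ L, y (a, s) * y (τ a, t) = 0)
    (p : MvPolynomial (α ⊕ β) k) : unsegre k y (quadPoly k β L τ * p) = 0 := by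
  classical
  suffices (unsegre k y) ∘ₗ (LinearMap.mulLeft k (quadPoly k β L τ)) = 0 from
    LinearMap.congr_fun this p
  refine (basisMonomials (α ⊕ β) k).ext fun m => ?_
  have key : ∀ a, X (Sum.inl a) * X (Sum.inl (τ a)) * monomial m (1 : k) =
      monomial (Finsupp.single (Sum.inl a) 1 + Finsupp.single (Sum.inl (τ a)) 1 + m) 1 := by
    intro a
    rw [X, X, monomial_mul, monomial_mul]; simp
  simp only [coe_basisMonomials, LinearMap.comp_apply, LinearMap.mulLeft_apply, quadPoly, quadForm,
    Finset.sum_mul, map_sum, key, LinearMap.zero_apply]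
  by_cases h : ∃ a ∈ L, ∃ s : Multiset (α × β), pairExponent s =
      Finsupp.single (Sum.inl a) 1 + Finsupp.single (Sum.inl (τ a)) 1 + m
  · obtain ⟨a, -, s, hs⟩ := h
    obtain ⟨j, hj⟩ : ∃ j, (a, j) ∈ s := by
      have : a ∈ s.map Prod.fst := by
        rw [← Multiset.count_pos, ← pairExponent_inl, hs]; simp
      obtain ⟨⟨i, j⟩, h, rfl⟩ := Multiset.mem_map.1 this
      exact ⟨j, h⟩
    obtain ⟨s, rfl⟩ := Multiset.exists_cons_of_mem hj
    rw [pairExponent_cons, add_assoc, add_assoc] at hs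
    have hs := add_left_cancel hs
    obtain ⟨j', hj'⟩ : ∃ j, (τ a, j) ∈ s := by
      have : τ a ∈ s.map Prod.fst := by
        have := DFunLike.congr_fun hs (Sum.inl (τ a))
        simp only [Finsupp.add_apply, pairExponent_inl] at this
        rw [← Multiset.count_pos]
        simp at this
        omega
      obtain ⟨⟨i, j⟩, h, h'⟩ := Multiset.mem_map.1 this
      exact ⟨j, h' ▸ h⟩
    obtain ⟨s, rfl⟩ := Multiset.exists_cons_of_mem hj'
    rw [pairExponent_cons, add_left_comm, add_assoc] at hs
    have hs := add_left_cancel hs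
    rw [← hs]
    -- What remains of `s` satisfies m = v_j v_{j'} · (monomial of `s`), so each b in `L` can be
    -- paired in the same way.
    have : ∀ b, unsegre k y (monomial (Finsupp.single (Sum.inl b) 1 +
        Finsupp.single (Sum.inl (τ b)) 1 + (Finsupp.single (Sum.inr j') 1 +
          (Finsupp.single (Sum.inr j) 1 + pairExponent s))) 1) =
        y (b, j) * y (τ b, j') * (s.map y).prod := by
      intro b
      have e : Finsupp.single (Sum.inl b) 1 +
        Finsupp.single (Sum.inl (τ b)) 1 + (Finsupp.single (Sum.inr j') 1 +
          (Finsupp.single (Sum.inr j) 1 + pairExponent s)) =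
          pairExponent ((b, j) ::ₘ (τ b, j') ::ₘ s) := by
        simp only [pairExponent_cons]; abel
      rw [e, unsegre_pairExponent k y hy]
      simp [mul_assoc]
    simp only [this]
    rw [← Finset.sum_mul, hL, zero_mul]
  · push Not at h
    exact Finset.sum_eq_zero fun a ha => unsegre_of_not_exists k y _ fun ⟨s, hs⟩ => h a ha s hs

/-- If p maps to q·g, apply `unsegre` with values in the quotient by the ideal: the left side
returns the class of p, the right side is 0. -/
theorem comap_segre_eq_quadIdeal (e : α × β ≃ σ) (L : Finset α) (τ : α → α) :
    (Ideal.span {quadPoly k β L τ}).comap (segre k e) = quadIdeal (genericMatrix k e) L τ := by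
  refine le_antisymm (fun p hp => ?_) (quadIdeal_le_comap e L τ)
  obtain ⟨g, hg⟩ := Ideal.mem_span_singleton.1 (Ideal.mem_comap.1 hp)
  set I := quadIdeal (genericMatrix k e) L τ with hI
  have hmin : ∀ i i' j j', Ideal.Quotient.mkₐ k I (X (e (i, j))) *
      Ideal.Quotient.mkₐ k I (X (e (i', j'))) =
      Ideal.Quotient.mkₐ k I (X (e (i, j'))) * Ideal.Quotient.mkₐ k I (X (e (i', j))) := by
    intro i i' j j'
    rw [← map_mul, ← map_mul]
    exact Ideal.Quotient.eq.2 (Ideal.subset_span (Or.inr ⟨i, i', j, j', rfl⟩))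
  have h := unsegre_segre e (Ideal.Quotient.mkₐ k I) hmin p
  rw [hg, unsegre_quadPoly_mul (fun p => Ideal.Quotient.mkₐ k I (X (e p))) hmin L τ] at h
  · exact Ideal.Quotient.eq_zero_iff_mem.1 h.symm
  · intro s t
    simp only [← map_mul, ← map_sum]
    exact Ideal.Quotient.eq_zero_iff_mem.2 (Ideal.subset_span (Or.inl ⟨s, t, rfl⟩))

end Segre

/-! ### Primality and dimension of the ideals of rank one matrices. -/

section RankOne

open MvPolynomial

variable {k : Type*} [Field k] {α β σ : Type*}

/-- Evaluation of polynomials in the entries of a matrix at the rank one matrix `u vᵗ`. -/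
def rankOneHom {R : Type*} [CommRing R] [Algebra k R] (e : α × β ≃ σ) (u : α → R) (v : β → R) :
    MvPolynomial σ k →ₐ[k] R :=
  aeval fun c => u (e.symm c).1 * v (e.symm c).2

@[simp]
theorem rankOneHom_genericMatrix {R : Type*} [CommRing R] [Algebra k R] (e : α × β ≃ σ)
    (u : α → R) (v : β → R) (i : α) (j : β) :
    rankOneHom e u v (genericMatrix k e i j) = u i * v j := by
  simp [rankOneHom, genericMatrix]

theorem rankOneHom_sum {R : Type*} [CommRing R] [Algebra k R] (e : α × β ≃ σ)
    (L : Finset α) (τ : α → α) (u : α → R) (v : β → R) (s t : β) :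
    rankOneHom e u v (∑ a ∈ L, genericMatrix k e a s * genericMatrix k e (τ a) t) =
      quadForm L τ u * (v s * v t) := by
  simp only [map_sum, map_mul, rankOneHom_genericMatrix, quadForm, Finset.sum_mul]
  exact Finset.sum_congr rfl fun a _ => by ring

theorem quadIdeal_le_ker_rankOneHom {R : Type*} [CommRing R] [Algebra k R] (e : α × β ≃ σ)
    (L : Finset α) (τ : α → α) (u : α → R) (v : β → R) (hu : quadForm L τ u = 0) :
    quadIdeal (genericMatrix k e) L τ ≤ RingHom.ker (rankOneHom (k := k) e u v) := by
  refine Ideal.span_le.2 ?_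
  rintro f (⟨s, t, rfl⟩ | ⟨i, t, j, s, rfl⟩)
  · refine RingHom.mem_ker.2 ?_
    rw [rankOneHom_sum, hu, zero_mul]
  · refine RingHom.mem_ker.2 ?_
    simp only [map_sub, map_mul, rankOneHom_genericMatrix]
    ring

/-- If `v ≠ 0`, the polynomials in `quadIdeal` vanish at `u vᵗ` only if `u` is isotropic. -/
theorem not_quadIdeal_le_ker_rankOneHom (e : α × β ≃ σ)
    (L : Finset α) (τ : α → α) (u : α → k) (v : β → k) (hu : quadForm L τ u ≠ 0) (j : β)
    (hv : v j ≠ 0) :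
    ¬ quadIdeal (genericMatrix k e) L τ ≤ RingHom.ker (rankOneHom (k := k) e u v) := by
  intro h
  have := h (Ideal.subset_span (Or.inl ⟨j, j, rfl⟩))
  rw [RingHom.mem_ker, rankOneHom_sum] at this
  exact mul_ne_zero hu (mul_ne_zero hv hv) this

/-- The monomials u_a u_{τ a} are at least two in number, with pairwise disjoint supports,
coefficient 1 and exponent 1 in u_a; such a sum admits no nontrivial factorization. With a single
term it would be a product of two variables. -/
theorem irreducible_quadPoly (L : Finset α) (τ : α → α) (hτL : ∀ a ∈ L, τ a ∉ L)
    (hτ : Set.InjOn τ L) (hL : L.Nontrivial) : Irreducible (quadPoly k β L τ) := by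
  classical
  let ι : α → (α ⊕ β →₀ ℕ) := fun a =>
    Finsupp.single (Sum.inl a) 1 + Finsupp.single (Sum.inl (τ a)) 1
  have hne : ∀ a ∈ L, ∀ b ∈ L, a ≠ τ b := fun a ha b hb h => hτL b hb (h ▸ ha)
  have hsupp : ∀ a, (ι a).support = {Sum.inl a, Sum.inl (τ a)} := by
    intro a
    ext x
    simp only [ι, Finsupp.mem_support_iff, Finsupp.add_apply, Finset.mem_insert,
      Finset.mem_singleton, Finsupp.single_apply]
    by_cases h1 : Sum.inl a = x <;> by_cases h2 : Sum.inl (τ a) = x <;>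
      (simp [h1, h2, eq_comm]; try tauto)
  have hinj : Set.InjOn ι L := by
    intro a ha b hb hab
    have h : Sum.inl a ∈ (ι b).support := by
      have : Sum.inl a ∈ (ι a).support := by rw [hsupp]; simp
      have hab' : ι a = ι b := hab
      rwa [hab'] at this
    rw [hsupp] at h
    simp only [Finset.mem_insert, Finset.mem_singleton, Sum.inl.injEq] at h
    exact h.resolve_right (hne a ha b hb)
  have hq : quadPoly k β L τ = ∑ a ∈ L, monomial (ι a) 1 := by
    refine Finset.sum_congr rfl fun a _ => ?_
    simp only [X, monomial_mul, one_mul, ι]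
  have hcoeff : ∀ m, coeff m (quadPoly k β L τ) = ∑ a ∈ L, if ι a = m then 1 else 0 := by
    intro m
    rw [hq, coeff_sum]
    exact Finset.sum_congr rfl fun a _ => by rw [coeff_monomial]
  have hcoeff1 : ∀ a ∈ L, coeff (ι a) (quadPoly k β L τ) = 1 := by
    intro a ha
    rw [hcoeff, Finset.sum_eq_single a]
    · simp
    · intro b hb hba
      exact if_neg fun h => hba (hinj hb ha h)
    · exact fun h => (h ha).elim
  have hmem : ∀ m ∈ (quadPoly k β L τ).support, ∃ a ∈ L, ι a = m := by
    intro m hm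
    by_contra h
    push Not at h
    rw [mem_support_iff, hcoeff] at hm
    exact hm (Finset.sum_eq_zero fun a ha => if_neg (h a ha))
  have hmem' : ∀ a ∈ L, ι a ∈ (quadPoly k β L τ).support := by
    intro a ha
    rw [mem_support_iff, hcoeff1 a ha]
    exact one_ne_zero
  obtain ⟨a, ha, b, hb, hab⟩ := hL
  refine irreducible_of_disjoint_support (d := ι a) (i := Sum.inl a)
    ⟨ι a, hmem' a ha, ι b, hmem' b hb, fun h => hab (hinj ha hb h)⟩ (hmem' a ha) ?_ ?_ ?_
  · have := hne a ha a ha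
    simp [ι, this.symm]
  · intro m hm m' hm' hmm'
    obtain ⟨c, hc, rfl⟩ := hmem m hm
    obtain ⟨d, hd, rfl⟩ := hmem m' hm'
    have hcd : c ≠ d := fun h => hmm' (h ▸ rfl)
    simp only [Function.onFun, hsupp]
    have h1 := hne c hc d hd
    have h2 := hne d hd c hc
    have h3 : τ c ≠ τ d := fun h => hcd (hτ hc hd h)
    simp [hcd.symm, h2, h1.symm, h3.symm]
  · intro x hx
    have := hx (ι a)
    rw [hcoeff1 a ha] at this
    exact isUnit_of_dvd_one this

theorem isPrime_span_quadPoly (L : Finset α) (τ : α → α) (hτL : ∀ a ∈ L, τ a ∉ L)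
    (hτ : Set.InjOn τ L) (hL : L.Nontrivial) : (Ideal.span {quadPoly k β L τ}).IsPrime :=
  (Ideal.span_singleton_prime (irreducible_quadPoly L τ hτL hτ hL).ne_zero).2
    (irreducible_quadPoly L τ hτL hτ hL).prime

theorem isPrime_quadIdeal (e : α × β ≃ σ) (L : Finset α) (τ : α → α) (hτL : ∀ a ∈ L, τ a ∉ L)
    (hτ : Set.InjOn τ L) (hL : L.Nontrivial) : (quadIdeal (genericMatrix k e) L τ).IsPrime := by
  have := isPrime_span_quadPoly (k := k) (β := β) L τ hτL hτ hL
  rw [← comap_segre_eq_quadIdeal]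
  exact Ideal.IsPrime.comap _

section Generic

variable [DecidableEq α]

/-- The polynomial ring in the coordinates of `genericU` and `genericV`. -/
abbrev CoordRing (k : Type*) [Field k] (τ : α → α) (a₀ : α) (j₀ : β) : Type _ :=
  MvPolynomial ({i // i ≠ τ a₀} ⊕ {j // j ≠ j₀}) k

/-- The isotropic vector whose coordinates other than the one at `τ a₀` are independent
variables. -/
def genericU (k : Type*) [Field k] (L : Finset α) (τ : α → α) (a₀ : α) (j₀ : β) :
    α → FractionRing (CoordRing k τ a₀ j₀) :=
  let y : α → FractionRing (CoordRing k τ a₀ j₀) := fun i =>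
    if h : i ≠ τ a₀ then algebraMap (CoordRing k τ a₀ j₀) _ (X (Sum.inl ⟨i, h⟩)) else 0
  -- The equation of the quadric is linear in the coordinate at τ a₀ with coefficient u_{a₀}, and is
  -- solved for it.
  Function.update y (τ a₀) (-(∑ a ∈ L.erase a₀, y a * y (τ a)) / y a₀)

theorem genericU_of_ne (L : Finset α) (τ : α → α) (a₀ : α) (j₀ : β) {i : α} (h : i ≠ τ a₀) :
    genericU k L τ a₀ j₀ i = algebraMap (CoordRing k τ a₀ j₀) _ (X (Sum.inl ⟨i, h⟩)) := by
  simp [genericU, h]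

theorem algebraMap_X_ne_zero {ι : Type*} (i : ι) :
    algebraMap (MvPolynomial ι k) (FractionRing (MvPolynomial ι k)) (X i) ≠ 0 := by
  rw [Ne, IsFractionRing.to_map_eq_zero_iff]
  exact X_ne_zero i

theorem quadForm_genericU (L : Finset α) (τ : α → α) (hτL : ∀ a ∈ L, τ a ∉ L)
    (hτ : Set.InjOn τ L) (a₀ : α) (ha₀ : a₀ ∈ L) (j₀ : β) :
    quadForm L τ (genericU k L τ a₀ j₀) = 0 := by
  have hne : ∀ a ∈ L, ∀ b ∈ L, a ≠ τ b := fun a ha b hb h => hτL b hb (h ▸ ha)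
  have hA : genericU k L τ a₀ j₀ a₀ ≠ 0 := by
    rw [genericU_of_ne _ _ _ _ (hne a₀ ha₀ a₀ ha₀)]
    exact algebraMap_X_ne_zero _
  have h : genericU k L τ a₀ j₀ (τ a₀) = -(∑ a ∈ L.erase a₀, genericU k L τ a₀ j₀ a *
      genericU k L τ a₀ j₀ (τ a)) / genericU k L τ a₀ j₀ a₀ := by
    conv_lhs => simp only [genericU, Function.update_self]
    rw [genericU_of_ne _ _ _ _ (hne a₀ ha₀ a₀ ha₀), dif_pos (hne a₀ ha₀ a₀ ha₀)]
    congr 2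
    refine Finset.sum_congr rfl fun a ha => ?_
    have haL := Finset.mem_of_mem_erase ha
    have h1 := hne a haL a₀ ha₀
    have h2 : τ a ≠ τ a₀ := fun h => Finset.ne_of_mem_erase ha (hτ haL ha₀ h)
    rw [dif_pos h1, dif_pos h2, genericU_of_ne _ _ _ _ h1, genericU_of_ne _ _ _ _ h2]
  rw [quadForm, ← Finset.add_sum_erase L _ ha₀, h]
  field_simp
  ring

variable [DecidableEq β]

/-- The vector `v` with `v_{j₀} = 1` and such that the entries `u_{a₀} v_j` with `j ≠ j₀` are
independent variables. -/
def genericV (k : Type*) [Field k] (L : Finset α) (τ : α → α) (a₀ : α) (j₀ : β) :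
    β → FractionRing (CoordRing k τ a₀ j₀) := fun j =>
  if h : j ≠ j₀ then algebraMap (CoordRing k τ a₀ j₀) _ (X (Sum.inr ⟨j, h⟩)) / genericU k L τ a₀ j₀ a₀ else 1

end Generic

/-- The entries of column j₀ other than (τ a₀, j₀), and those of row a₀ other than (a₀, j₀), form a
transcendence basis. They are independent because they become distinct variables at the generic rank
one matrix, and the quadric and the minors make all other entries algebraic over them. -/
theorem ringKrullDim_quotient_quadIdeal [Finite α] [Finite β] (e : α × β ≃ σ) (L : Finset α)
    (τ : α → α) (hτL : ∀ a ∈ L, τ a ∉ L) (hτ : Set.InjOn τ L) (hL : L.Nontrivial) (j₀ : β) :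
    ringKrullDim (MvPolynomial σ k ⧸ quadIdeal (genericMatrix k e) L τ) =
      ((Nat.card α + Nat.card β - 2 : ℕ) : WithBot ℕ∞) := by
  classical
  obtain ⟨a₀, ha₀⟩ := hL.nonempty
  have hne : ∀ a ∈ L, ∀ b ∈ L, a ≠ τ b := fun a ha b hb h => hτL b hb (h ▸ ha)
  have := isPrime_quadIdeal (k := k) e L τ hτL hτ hL
  have : Finite σ := Finite.of_equiv _ e
  set I := quadIdeal (genericMatrix k e) L τ with hI
  let x : α → β → MvPolynomial σ k ⧸ I := fun i j => Ideal.Quotient.mk I (genericMatrix k e i j)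
  have hminor : ∀ i i' j j', x i j * x i' j' = x i j' * x i' j := by
    intro i i' j j'
    simp only [x, ← map_mul]
    exact Ideal.Quotient.eq.2 (Ideal.subset_span (Or.inr ⟨i, i', j, j', rfl⟩))
  have hquad : ∀ s t, ∑ a ∈ L, x a s * x (τ a) t = 0 := by
    intro s t
    simp only [x, ← map_mul, ← map_sum]
    exact Ideal.Quotient.eq_zero_iff_mem.2 (Ideal.subset_span (Or.inl ⟨s, t, rfl⟩))
  let y : {i // i ≠ τ a₀} ⊕ {j // j ≠ j₀} → MvPolynomial σ k ⧸ I :=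
    Sum.elim (fun i => x i j₀) (fun j => x a₀ j)
  have hU := quadForm_genericU (k := k) L τ hτL hτ a₀ ha₀ j₀
  let f := Ideal.Quotient.liftₐ I
    (rankOneHom (k := k) e (genericU k L τ a₀ j₀) (genericV k L τ a₀ j₀))
    fun p hp => quadIdeal_le_ker_rankOneHom e L τ _ _ hU hp
  have hf : ∀ i j, f (x i j) = genericU k L τ a₀ j₀ i * genericV k L τ a₀ j₀ j := fun i j =>
    rankOneHom_genericMatrix e _ _ i j
  have ha₀' := hne a₀ ha₀ a₀ ha₀
  have hA : genericU k L τ a₀ j₀ a₀ ≠ 0 := by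
    rw [genericU_of_ne _ _ _ _ ha₀']
    exact algebraMap_X_ne_zero _
  have hind : AlgebraicIndependent k y := by
    refine AlgebraicIndependent.of_comp f ?_
    have : f ∘ y = algebraMap (CoordRing k τ a₀ j₀) (FractionRing (CoordRing k τ a₀ j₀)) ∘ X := by
      funext m
      rcases m with ⟨i, hi⟩ | ⟨j, hj⟩
      · simp only [y, Function.comp_apply, Sum.elim_inl, hf, genericU_of_ne _ _ _ _ hi]
        simp [genericV]
      · simp only [y, Function.comp_apply, Sum.elim_inr, hf, genericV]
        rw [dif_pos hj, mul_div_cancel₀ _ hA]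
    rw [this]
    exact ((MvPolynomial.algebraicIndependent_X _ k).map'
      (f := IsScalarTower.toAlgHom k _ _) (IsFractionRing.injective _ _))
  have hx₀ : x a₀ j₀ ≠ 0 := fun h => by
    have := hf a₀ j₀
    rw [h, map_zero] at this
    refine hA ?_
    simpa [genericV] using this.symm
  have hb : IsTranscendenceBasis k y := by
    rw [hind.isTranscendenceBasis_iff_isAlgebraic]
    have hadj : ∀ m, IsAlgebraic (Algebra.adjoin k (Set.range y)) (y m) := fun m =>
      isAlgebraic_algebraMap (⟨y m, Algebra.subset_adjoin ⟨m, rfl⟩⟩ :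
        Algebra.adjoin k (Set.range y))
    have h1 : ∀ i, i ≠ τ a₀ → IsAlgebraic (Algebra.adjoin k (Set.range y)) (x i j₀) :=
      fun i hi => hadj (Sum.inl ⟨i, hi⟩)
    have h0 := h1 a₀ ha₀'
    have hreg := mem_nonZeroDivisors_of_ne_zero hx₀
    have h2 : ∀ i, IsAlgebraic (Algebra.adjoin k (Set.range y)) (x i j₀) := by
      intro i
      by_cases hi : i = τ a₀
      · subst hi
        -- The quadric equation in column j₀ expresses x_{a₀ j₀} x_{τ a₀, j₀} through the other
        -- entries of that column.
        refine IsAlgebraic.of_mul hreg h0 ?_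
        have := hquad j₀ j₀
        rw [← Finset.add_sum_erase L _ ha₀] at this
        rw [eq_neg_of_add_eq_zero_left this]
        refine IsAlgebraic.neg ((Subalgebra.algebraicClosure _ _).sum_mem fun a ha => ?_)
        have haL := Finset.mem_of_mem_erase ha
        refine (h1 a (hne a haL a₀ ha₀)).mul (h1 _ ?_)
        exact fun h => Finset.ne_of_mem_erase ha (hτ haL ha₀ h)
      · exact h1 i hi
    have h3 : ∀ j, IsAlgebraic (Algebra.adjoin k (Set.range y)) (x a₀ j) := by
      intro j
      by_cases hj : j = j₀
      · rw [hj]; exact h0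
      · exact hadj (Sum.inr ⟨j, hj⟩)
    have h4 : ∀ i j, IsAlgebraic (Algebra.adjoin k (Set.range y)) (x i j) := by
      intro i j
      -- By a minor, x_{a₀ j₀} x_{i j} = x_{i j₀} x_{a₀ j}.
      refine IsAlgebraic.of_mul hreg h0 ?_
      rw [hminor, mul_comm]
      exact (h2 i).mul (h3 j)
    refine ⟨fun z => ?_⟩
    obtain ⟨p, rfl⟩ := Ideal.Quotient.mk_surjective z
    induction p using MvPolynomial.induction_on with
    | C c => exact isAlgebraic_algebraMap
               (algebraMap k (Algebra.adjoin k (Set.range y)) c)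
    | add p q hp hq => rw [map_add]; exact hp.add hq
    | mul_X p c hp =>
      rw [map_mul]
      refine hp.mul ?_
      have := h4 (e.symm c).1 (e.symm c).2
      simpa [x, genericMatrix] using this
  rw [ringKrullDim_eq_card_of_isTranscendenceBasis hb, Nat.card_sum]
  have c1 : Nat.card {i // i ≠ τ a₀} = Nat.card α - 1 := by
    have := Fintype.ofFinite α
    simp [Nat.card_eq_fintype_card, Fintype.card_subtype_compl]
  have c2 : Nat.card {j // j ≠ j₀} = Nat.card β - 1 := by
    have := Fintype.ofFinite β
    simp [Nat.card_eq_fintype_card, Fintype.card_subtype_compl]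
  have p1 : 0 < Nat.card α := Nat.card_pos_iff.2 ⟨⟨a₀⟩, inferInstance⟩
  have p2 : 0 < Nat.card β := Nat.card_pos_iff.2 ⟨⟨j₀⟩, inferInstance⟩
  rw [c1, c2]
  congr 2
  omega

/-! ### Matrices with two rows, one of which vanishes -/

theorem ker_rankOneHom_of_two_rows [DecidableEq α] (e : α × β ≃ σ) (i₀ i₁ : α) (h : i₀ ≠ i₁)
    (hα : ∀ i, i = i₀ ∨ i = i₁) :
    RingHom.ker (rankOneHom (k := k) (R := MvPolynomial β k) e (fun i => if i = i₀ then 0 else 1)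
      X) = Ideal.span {f | ∃ j, f = genericMatrix k e i₀ j} := by
  apply le_antisymm
  · set I := Ideal.span {f | ∃ j, f = genericMatrix k e i₀ j} with hI
    set φ := rankOneHom (k := k) (R := MvPolynomial β k) e (fun i => if i = i₀ then 0 else 1) X
      with hφ
    let g : MvPolynomial β k →ₐ[k] MvPolynomial σ k := aeval fun j => X (e (i₁, j))
    -- Putting the surviving row back is inverse to `φ` modulo the vanishing row, so the kernel of
    -- `φ` lies in `I`.
    have : ((Ideal.Quotient.mkₐ k I).comp g).comp φ = Ideal.Quotient.mkₐ k I := by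
      refine MvPolynomial.algHom_ext fun c => ?_
      obtain ⟨⟨i, j⟩, rfl⟩ := e.surjective c
      have h1 : φ (X (e (i, j))) = (if i = i₀ then 0 else 1) * X j :=
        rankOneHom_genericMatrix e _ _ i j
      rw [AlgHom.comp_apply, h1]
      rcases hα i with rfl | rfl
      · rw [if_pos rfl, zero_mul, map_zero]
        exact (Ideal.Quotient.eq_zero_iff_mem.2 (Ideal.subset_span (s := {f | ∃ j, f = genericMatrix k e i j})
          ⟨j, rfl⟩)).symm
      · simp [h.symm, g]
    intro p hp
    have h2 := AlgHom.congr_fun this p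
    rw [AlgHom.comp_apply, RingHom.mem_ker.1 hp, map_zero] at h2
    exact Ideal.Quotient.eq_zero_iff_mem.1 h2.symm
  · refine Ideal.span_le.2 ?_
    rintro f ⟨j, rfl⟩
    refine RingHom.mem_ker.2 ?_
    simp

theorem ringKrullDim_quotient_of_two_rows [DecidableEq α] [Finite β] (e : α × β ≃ σ) (i₀ i₁ : α)
    (h : i₀ ≠ i₁) (hα : ∀ i, i = i₀ ∨ i = i₁) :
    ringKrullDim (MvPolynomial σ k ⧸ Ideal.span {f | ∃ j, f = genericMatrix k e i₀ j}) =
      Nat.card β := by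
  rw [← ker_rankOneHom_of_two_rows e i₀ i₁ h hα]
  have hs : Function.Surjective (rankOneHom (k := k) (R := MvPolynomial β k) e
      (fun i => if i = i₀ then 0 else 1) X) := by
    intro p
    refine ⟨aeval (fun j => X (e (i₁, j))) p, ?_⟩
    rw [← AlgHom.comp_apply]
    conv_rhs => rw [← AlgHom.id_apply (R := k) p]
    congr 1
    refine MvPolynomial.algHom_ext fun j => ?_
    have := rankOneHom_genericMatrix (k := k) (R := MvPolynomial β k) e
      (fun i => if i = i₀ then 0 else 1) X i₁ j
    simpa [h.symm, genericMatrix] using this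
  refine (ringKrullDim_eq_of_ringEquiv (RingHom.quotientKerEquivOfSurjective
    (f := RingHomClass.toRingHom (rankOneHom (k := k) (R := MvPolynomial β k) e
      (fun i => if i = i₀ then 0 else 1) X)) hs)).trans ?_
  rw [MvPolynomial.ringKrullDim_of_isNoetherianRing, ringKrullDim_eq_zero_of_field, zero_add]

theorem isPrime_of_two_rows [DecidableEq α] (e : α × β ≃ σ) (i₀ i₁ : α)
    (h : i₀ ≠ i₁) (hα : ∀ i, i = i₀ ∨ i = i₁) :
    (Ideal.span {f | ∃ j, f = genericMatrix k e i₀ j}).IsPrime := by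
  rw [← ker_rankOneHom_of_two_rows e i₀ i₁ h hα]
  exact RingHom.ker_isPrime _

end RankOne

/-! ### The equations of the chart, entry by entry -/

section Entries

variable {n r : ℕ}

theorem mem_Z {i : Fin (2 * n)} : i ∈ Z n r ↔ n ≤ (i : ℕ) + r ∧ (i : ℕ) < n + r := by
  simp [Z]

theorem mem_Zc {i : Fin (2 * n)} : i ∈ Zc n r ↔ ¬ (n ≤ (i : ℕ) + r ∧ (i : ℕ) < n + r) := by
  simp only [Zc, Finset.mem_compl, mem_Z]

theorem mem_lo {i : Fin (2 * n)} : i ∈ lo n r ↔ (i : ℕ) + r < n := by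
  simp [lo]

theorem mem_hi {i : Fin (2 * n)} : i ∈ hi n r ↔ n + r ≤ (i : ℕ) := by
  simp [hi]

theorem rev_mem_Z_iff {i : Fin (2 * n)} : i.rev ∈ Z n r ↔ i ∈ Z n r :=
  ⟨fun h => by simpa using rev_mem_Z h, rev_mem_Z⟩

/-- The lower half of `Z`. -/
def loZ (n r : ℕ) : Finset (Fin (2 * n)) := (Z n r).filter fun i => (i : ℕ) < n

theorem mem_loZ {i : Fin (2 * n)} : i ∈ loZ n r ↔ n ≤ (i : ℕ) + r ∧ (i : ℕ) < n := by
  simp only [loZ, Finset.mem_filter, mem_Z]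
  omega

theorem sum_Z_eq {T : Type*} [AddCommMonoid T] (f : Fin (2 * n) → T) :
    ∑ a ∈ Z n r, f a = ∑ a ∈ loZ n r, f a + ∑ a ∈ loZ n r, f a.rev := by
  rw [← Finset.sum_filter_add_sum_filter_not (Z n r) (fun i => (i : ℕ) < n)]
  congr 1
  refine Finset.sum_bij' (fun a _ => a.rev) (fun a _ => a.rev) ?_ ?_ ?_ ?_ ?_ <;>
    intro a ha <;> simp only [Finset.mem_filter, mem_Z, mem_loZ, Fin.val_rev, Fin.rev_rev] at *
  · omega
  · omega

theorem sum_Zc_eq {T : Type*} [AddCommMonoid T] (f : Fin (2 * n) → T) :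
    ∑ a ∈ Zc n r, f a = ∑ a ∈ lo n r, f a + ∑ a ∈ lo n r, f a.rev := by
  rw [← Finset.sum_filter_add_sum_filter_not (Zc n r) (fun i => (i : ℕ) < n)]
  congr 1
  · refine Finset.sum_congr ?_ fun _ _ => rfl
    ext a
    simp only [Finset.mem_filter, mem_Zc, mem_lo]
    omega
  · refine Finset.sum_bij' (fun a _ => a.rev) (fun a _ => a.rev) ?_ ?_ ?_ ?_ ?_ <;>
      intro a ha <;> simp only [Finset.mem_filter, mem_Zc, mem_lo, Fin.val_rev, Fin.rev_rev] at *
    · omega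
    · omega

theorem sum_Z_add_sum_Zc {T : Type*} [AddCommMonoid T] (f : Fin (2 * n) → T) :
    ∑ a ∈ Z n r, f a + ∑ a ∈ Zc n r, f a = ∑ a, f a :=
  Finset.sum_add_sum_compl _ _

variable {R : Type*} [CommRing R] (M : Matrix (Fin (2 * n)) (Fin (2 * n)) R)

theorem S₀_mul_apply (i j : Fin (2 * n)) :
    (S₀ R n r * M) i j = if i ∈ Z n r then 0 else M i.rev j := by
  rw [Matrix.mul_apply, Finset.sum_eq_single i.rev]
  · by_cases h : i ∈ Z n r <;> simp [S₀, h]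
  · intro b _ hb
    have : i ≠ b.rev := fun h => hb (by rw [h, Fin.rev_rev])
    simp [S₀, this]
  · simp

theorem S₁_mul_apply (i j : Fin (2 * n)) :
    (S₁ R n r * M) i j = if i ∈ Z n r then M i.rev j else 0 := by
  rw [Matrix.mul_apply, Finset.sum_eq_single i.rev]
  · by_cases h : i ∈ Z n r <;> simp [S₁, h]
  · intro b _ hb
    have : i ≠ b.rev := fun h => hb (by rw [h, Fin.rev_rev])
    simp [S₁, this]
  · simp

theorem transpose_mul_S₀_mul_apply (i j : Fin (2 * n)) :
    (M.transpose * S₀ R n r * M) i j = ∑ a ∈ Zc n r, M a i * M a.rev j := by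
  rw [Matrix.mul_assoc, Matrix.mul_apply, ← sum_Z_add_sum_Zc (r := r)]
  simp only [S₀_mul_apply, Matrix.transpose_apply]
  rw [Finset.sum_eq_zero fun a ha => by rw [if_pos ha, mul_zero], zero_add]
  exact Finset.sum_congr rfl fun a ha => by rw [if_neg (Finset.mem_compl.1 ha)]

theorem transpose_mul_S₁_mul_apply (i j : Fin (2 * n)) :
    (M.transpose * S₁ R n r * M) i j = ∑ a ∈ Z n r, M a i * M a.rev j := by
  rw [Matrix.mul_assoc, Matrix.mul_apply, ← sum_Z_add_sum_Zc (r := r)]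
  simp only [S₁_mul_apply, Matrix.transpose_apply]
  rw [Finset.sum_congr rfl fun a ha => by rw [if_pos ha], add_eq_left]
  exact Finset.sum_eq_zero fun a ha => by rw [if_neg (Finset.mem_compl.1 ha), mul_zero]

theorem block_mul_Jmid_apply (i j : Z n r) :
    (block M (Z n r) (Z n r) * Jmid R n r) i j = M i j.1.rev := by
  rw [Matrix.mul_apply, Finset.sum_eq_single (revZ j)]
  · simp [block, Jmid, J, revZ]
  · intro b _ hb
    have : b.1 ≠ j.1.rev := fun h => hb (Subtype.ext h)
    simp [block, Jmid, J, this]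
  · simp

theorem Jmid_mul_block_transpose_apply (i j : Z n r) :
    (Jmid R n r * (block M (Z n r) (Z n r)).transpose) i j = M j i.1.rev := by
  rw [Matrix.mul_apply, Finset.sum_eq_single (revZ i)]
  · simp [block, Jmid, J, revZ]
  · intro b _ hb
    have : i.1 ≠ b.1.rev := fun h => hb (Subtype.ext (by simp [h, revZ]))
    simp [block, Jmid, J, this]
  · simp

theorem block_mul_Jout_mul_transpose_apply (i j : Z n r) :
    (block M (Z n r) (hi n r) * Jout R n r * (block M (Z n r) (lo n r)).transpose) i j =
      ∑ c ∈ lo n r, M i c.rev * M j c := by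
  rw [Matrix.mul_apply, ← Finset.sum_coe_sort (lo n r)]
  refine Finset.sum_congr rfl fun c _ => ?_
  congr 1
  have hc : c.1.rev ∈ hi n r := by
    have := mem_lo.1 c.2
    simp only [mem_hi, Fin.val_rev]
    omega
  rw [Matrix.mul_apply, Finset.sum_eq_single ⟨c.1.rev, hc⟩]
  · simp [block, Jout, J]
  · intro b _ hb
    have : b.1 ≠ c.1.rev := fun h => hb (Subtype.ext h)
    simp [block, Jout, J, this]
  · simp

end Entries

/-! ### Equations at π = 0 and their rank one solutions. -/

section Chart

variable {O : Type*} [CommRing O] {n r : ℕ}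

/-- The equations of the chart for `π = 0`. -/
structure IsFiberPoint {T : Type*} [CommRing T] (n r : ℕ)
    (M : Matrix (Fin (2 * n)) (Fin (2 * n)) T) : Prop where
  sq : ∀ i j, ∑ a, M i a * M a j = 0
  minor : ∀ i t j s, M i j * M t s = M i s * M t j
  form₀ : ∀ i j, ∑ a ∈ Zc n r, M a i * M a.rev j = 0
  form₁ : ∀ i j, ∑ a ∈ Z n r, M a i * M a.rev j + 2 * (if i ∈ Z n r then 0 else M i.rev j) = 0
  trace : ∑ a, M a a = 0
  traceA : ∑ a ∈ Z n r, M a a = 0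
  symm : ∀ i ∈ Z n r, ∀ j ∈ Z n r, M i j.rev = M j i.rev
  middle : ∀ i ∈ Z n r, ∀ j ∈ Z n r, ∑ c ∈ lo n r, M i c.rev * M j c = M i j.rev

/-- Describes algebra maps out of the chart by matrices satisfying the reduced equations; used both
for the tautological matrix and to construct points. -/
theorem isFiberPoint_iff {T : Type*} [CommRing T] [Algebra O T] (π : O)
    (hπ : algebraMap O T π = 0) (M : Matrix (Fin (2 * n)) (Fin (2 * n)) T) :
    IsFiberPoint n r M ↔ idealNaive π n r ⊔ idealAdd π n r ≤
      RingHom.ker (MvPolynomial.aeval (R := O) fun p : Fin (2 * n) × Fin (2 * n) => M p.1 p.2) := by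
  set φ := MvPolynomial.aeval (R := O) fun p : Fin (2 * n) × Fin (2 * n) => M p.1 p.2 with hφ
  have hX : ∀ i j, φ (genX O n i j) = M i j := fun i j => by simp [hφ, genX]
  have hs : ∀ (c : O) (t : T), (c * π) • t = 0 := fun c t => by
    rw [Algebra.smul_def, map_mul, hπ, mul_zero, zero_mul]
  have hs' : ∀ (t : T), π • t = 0 := fun t => by rw [Algebra.smul_def, hπ, zero_mul]
  have e1 : ∀ i j, φ ((genX O n * genX O n) i j) = ∑ a, M i a * M a j := by
    intro i j
    simp only [Matrix.mul_apply, map_sum, map_mul, hX]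
  have e2 : ∀ i t j s, φ (genX O n i j * genX O n t s - genX O n i s * genX O n t j) =
      M i j * M t s - M i s * M t j := by
    intro i t j s
    simp only [map_sub, map_mul, hX]
  have e3 : ∀ i j, φ (((genX O n).transpose * S₀ (PolyX O n) n r * genX O n - (2 * π) •
      (S₀ (PolyX O n) n r * genX O n + π • (S₁ (PolyX O n) n r * genX O n))) i j) =
      ∑ a ∈ Zc n r, M a i * M a.rev j := by
    intro i j
    rw [Matrix.sub_apply, Matrix.smul_apply, map_sub, map_smul, hs, sub_zero,
      transpose_mul_S₀_mul_apply]
    simp only [map_sum, map_mul, hX]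
  have e4 : ∀ i j, φ (((genX O n).transpose * S₁ (PolyX O n) n r * genX O n + (2 : O) •
      (S₀ (PolyX O n) n r * genX O n + π • (S₁ (PolyX O n) n r * genX O n))) i j) =
      ∑ a ∈ Z n r, M a i * M a.rev j + 2 * (if i ∈ Z n r then 0 else M i.rev j) := by
    intro i j
    rw [Matrix.add_apply, Matrix.smul_apply, Matrix.add_apply, Matrix.smul_apply, map_add,
      map_smul, map_add, map_smul, hs', add_zero, transpose_mul_S₁_mul_apply, S₀_mul_apply]
    simp only [map_sum, map_mul, hX, Algebra.smul_def, apply_ite φ, map_zero, map_ofNat]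
  have e5 : φ (genX O n).trace = ∑ a, M a a := by
    simp only [Matrix.trace, Matrix.diag, map_sum, hX]
  have e6 : φ ((blockA O n r).trace + MvPolynomial.C (2 * π)) = ∑ a ∈ Z n r, M a a := by
    have : φ (MvPolynomial.C (2 * π)) = 0 := by
      rw [← MvPolynomial.algebraMap_eq, AlgHom.commutes, map_mul, hπ, mul_zero]
    rw [map_add, this, add_zero, ← Finset.sum_coe_sort (Z n r)]
    simp only [Matrix.trace, Matrix.diag, map_sum, blockA, block, Matrix.submatrix_apply, hX]
  have e7 : ∀ i j, φ ((blockA O n r * Jmid (PolyX O n) n r -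
      Jmid (PolyX O n) n r * (blockA O n r).transpose) i j) = M i j.1.rev - M j i.1.rev := by
    intro i j
    rw [Matrix.sub_apply, blockA, block_mul_Jmid_apply, Jmid_mul_block_transpose_apply, map_sub,
      hX, hX]
  have e8 : ∀ i j, φ ((blockB₂ O n r * Jout (PolyX O n) n r * (blockB₁ O n r).transpose -
      blockA O n r * Jmid (PolyX O n) n r) i j) =
      ∑ c ∈ lo n r, M i c.rev * M j c - M i j.1.rev := by
    intro i j
    rw [Matrix.sub_apply, blockA, blockB₁, blockB₂, block_mul_Jmid_apply,
      block_mul_Jout_mul_transpose_apply]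
    simp only [map_sub, map_sum, map_mul, hX]
  constructor
  · intro h
    refine sup_le (Ideal.span_le.2 ?_) (Ideal.span_le.2 ?_)
    · rintro f (((⟨i, j, rfl⟩ | ⟨i, t, j, s, rfl⟩) | ⟨i, j, rfl⟩) | ⟨i, j, rfl⟩) <;>
        refine RingHom.mem_ker.2 ?_
      · rw [e1]; exact h.sq i j
      · rw [e2]; exact sub_eq_zero.2 (h.minor i t j s)
      · rw [e3]; exact h.form₀ i j
      · rw [e4]; exact h.form₁ i j
    · rintro f (((rfl | rfl) | ⟨i, j, rfl⟩) | ⟨i, j, rfl⟩) <;> refine RingHom.mem_ker.2 ?_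
      · rw [e5]; exact h.trace
      · rw [e6]; exact h.traceA
      · rw [e7]; exact sub_eq_zero.2 (h.symm i i.2 j j.2)
      · rw [e8]; exact sub_eq_zero.2 (h.middle i i.2 j j.2)
  · intro h
    have h1 := Ideal.span_le.1 (le_sup_left.trans h)
    have h2 := Ideal.span_le.1 (le_sup_right.trans h)
    refine ⟨fun i j => ?_, fun i t j s => ?_, fun i j => ?_, fun i j => ?_, ?_, ?_,
      fun i hi j hj => ?_, fun i hi j hj => ?_⟩
    · rw [← e1]; exact h1 (Or.inl (Or.inl (Or.inl ⟨i, j, rfl⟩)))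
    · rw [← sub_eq_zero, ← e2]; exact h1 (Or.inl (Or.inl (Or.inr ⟨i, t, j, s, rfl⟩)))
    · rw [← e3]; exact h1 (Or.inl (Or.inr ⟨i, j, rfl⟩))
    · rw [← e4]; exact h1 (Or.inr ⟨i, j, rfl⟩)
    · rw [← e5]; exact h2 (Or.inl (Or.inl (Or.inl rfl)))
    · rw [← e6]; exact h2 (Or.inl (Or.inl (Or.inr rfl)))
    · rw [← sub_eq_zero, ← e7 ⟨i, hi⟩ ⟨j, hj⟩]; exact h2 (Or.inl (Or.inr ⟨_, _, rfl⟩))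
    · rw [← sub_eq_zero, ← e8 ⟨i, hi⟩ ⟨j, hj⟩]; exact h2 (Or.inr ⟨_, _, rfl⟩)

/-- The rank one points of the chart. -/
theorem isFiberPoint_rankOne {T : Type*} [CommRing T] (u v : Fin (2 * n) → T) (q q' : T)
    (hq : q = ∑ a ∈ loZ n r, u a * u a.rev) (hq' : q' = ∑ a ∈ lo n r, v a * v a.rev)
    (h : q * q' = 0) :
    IsFiberPoint n r (Matrix.of fun i j => (if i ∈ Z n r then u i else -q * v i.rev) *
      (if j ∈ Z n r then q' * u j.rev else v j)) := by
  -- The matrix is w zᵗ, so X² = (∑ w_a z_a) X, and each form equation involves z_i z_j times the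
  -- form evaluated at w. The equations reduce to `htr`, `hA`, `h0`, `h1`; the entries -q v_{d+1-i}
  -- of w are what `form₁` requires off Z, and q' u_{d+1-j} in z is what `middle` requires on Z.
  set w : Fin (2 * n) → T := fun i => if i ∈ Z n r then u i else -q * v i.rev with hw
  set z : Fin (2 * n) → T := fun j => if j ∈ Z n r then q' * u j.rev else v j with hz
  have hwZ : ∀ i ∈ Z n r, w i = u i := fun i hi => if_pos hi
  have hzZ : ∀ i ∈ Z n r, z i = q' * u i.rev := fun i hi => if_pos hi
  have hwc : ∀ i, i ∉ Z n r → w i = -q * v i.rev := fun i hi => if_neg hi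
  have hzc : ∀ i, i ∉ Z n r → z i = v i := fun i hi => if_neg hi
  have hqZ : ∑ a ∈ Z n r, u a * u a.rev = 2 * q := by
    rw [sum_Z_eq, two_mul q, hq]
    simp only [Fin.rev_rev, mul_comm]
  have hqZc : ∑ a ∈ Zc n r, v a * v a.rev = 2 * q' := by
    rw [sum_Zc_eq, two_mul q', hq']
    simp only [Fin.rev_rev, mul_comm]
  have hA : ∑ a ∈ Z n r, w a * z a = 0 := by
    rw [Finset.sum_congr rfl fun a ha => show w a * z a = q' * (u a * u a.rev) by
      rw [hwZ a ha, hzZ a ha]; ring, ← Finset.mul_sum, hqZ]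
    linear_combination 2 * h
  have hAc : ∑ a ∈ Zc n r, w a * z a = 0 := by
    rw [Finset.sum_congr rfl fun a ha => show w a * z a = -q * (v a * v a.rev) by
      rw [hwc a (Finset.mem_compl.1 ha), hzc a (Finset.mem_compl.1 ha)]; ring,
      ← Finset.mul_sum, hqZc]
    linear_combination -2 * h
  have htr : ∑ a, w a * z a = 0 := by
    rw [← sum_Z_add_sum_Zc (r := r), hA, hAc, add_zero]
  have h0 : ∑ a ∈ Zc n r, w a * w a.rev = 0 := by
    rw [Finset.sum_congr rfl fun a ha => show w a * w a.rev = q * q * (v a * v a.rev) by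
      rw [hwc a (Finset.mem_compl.1 ha), hwc a.rev (Finset.mem_compl.1 (rev_mem_Zc ha)),
        Fin.rev_rev]; ring, ← Finset.mul_sum, hqZc]
    linear_combination 2 * q * h
  have h1 : ∑ a ∈ Z n r, w a * w a.rev = 2 * q := by
    rw [Finset.sum_congr rfl fun a ha => show w a * w a.rev = u a * u a.rev by
      rw [hwZ a ha, hwZ _ (rev_mem_Z ha)], hqZ]
  refine ⟨fun i j => ?_, fun i t j s => ?_, fun i j => ?_, fun i j => ?_, htr, hA,
    fun i hi j hj => ?_, fun i hi j hj => ?_⟩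
  · change ∑ a, (w i * z a) * (w a * z j) = 0
    rw [Finset.sum_congr rfl fun a _ => show (w i * z a) * (w a * z j) =
      (w i * z j) * (w a * z a) by ring, ← Finset.mul_sum, htr, mul_zero]
  · change (w i * z j) * (w t * z s) = (w i * z s) * (w t * z j)
    ring
  · change ∑ a ∈ Zc n r, (w a * z i) * (w a.rev * z j) = 0
    rw [Finset.sum_congr rfl fun a _ => show (w a * z i) * (w a.rev * z j) =
      (z i * z j) * (w a * w a.rev) by ring, ← Finset.mul_sum, h0, mul_zero]
  · change ∑ a ∈ Z n r, (w a * z i) * (w a.rev * z j) +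
      2 * (if i ∈ Z n r then 0 else w i.rev * z j) = 0
    rw [Finset.sum_congr rfl fun a _ => show (w a * z i) * (w a.rev * z j) =
      (z i * z j) * (w a * w a.rev) by ring, ← Finset.mul_sum, h1]
    by_cases hi : i ∈ Z n r
    · rw [if_pos hi, hzZ i hi]
      linear_combination 2 * u i.rev * z j * h
    · rw [if_neg hi, hwc i.rev (mt rev_mem_Z_iff.1 hi), hzc i hi, Fin.rev_rev]
      ring
  · change w i * z j.rev = w j * z i.rev
    rw [hwZ i hi, hwZ j hj, hzZ _ (rev_mem_Z hi), hzZ _ (rev_mem_Z hj), Fin.rev_rev, Fin.rev_rev]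
    ring
  · change ∑ c ∈ lo n r, (w i * z c.rev) * (w j * z c) = w i * z j.rev
    have hlo : ∀ c ∈ lo n r, c ∉ Z n r := fun c hc => by
      rw [mem_Z]; rw [mem_lo] at hc; omega
    rw [Finset.sum_congr rfl fun c hc => show (w i * z c.rev) * (w j * z c) =
      (u i * u j) * (v c * v c.rev) by
      rw [hwZ i hi, hwZ j hj, hzc c (hlo c hc), hzc c.rev (mt rev_mem_Z_iff.1 (hlo c hc))]; ring,
      ← Finset.mul_sum, ← hq', hwZ i hi, hzZ _ (rev_mem_Z hj), Fin.rev_rev]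
    ring

end Chart

/-! ### The coordinate ring of the special fiber. -/

section Fiber

theorem eq_smul_of_add_two_mul_eq_zero {k T : Type*} [Field k] [CommRing T] [Algebra k T]
    (h2 : (2 : k) ≠ 0) {s x : T} (h : s + 2 * x = 0) : x = (-(2 : k)⁻¹) • s := by
  rw [eq_neg_of_add_eq_zero_left h, neg_smul, smul_neg, neg_neg,
    show (2 : T) * x = (2 : k) • x by rw [Algebra.smul_def, map_ofNat],
    smul_smul, inv_mul_cancel₀ h2, one_smul]

theorem isUnit_two_of_algebra {k T : Type*} [Field k] [CommRing T] [Algebra k T]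
    (h2 : (2 : k) ≠ 0) : IsUnit (2 : T) := by
  simpa only [map_ofNat] using (isUnit_iff_ne_zero.2 h2).map (algebraMap k T)

/-- The minors move all the indices i, j, s, t into a common factor b_{js} b_{it}. The other factor
is, by `middle`, half of Tr A, hence 0. -/
theorem IsFiberPoint.quad_mul_quad {T : Type*} [CommRing T] (h2 : IsUnit (2 : T)) {n r : ℕ} {b : Matrix (Fin (2 * n)) (Fin (2 * n)) T}
    (hM : IsFiberPoint n r b) (i j s t : Fin (2 * n)) :
    (∑ a ∈ loZ n r, b a s * b a.rev t) * (∑ c ∈ lo n r, b i c * b j c.rev) = 0 := by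
  have htr : ∑ a ∈ loZ n r, ∑ c ∈ lo n r, b a c.rev * b a.rev c = 0 := by
    have h := hM.traceA
    rw [sum_Z_eq, ← Finset.sum_add_distrib] at h
    -- `middle` expands the diagonal entries at a and at its reverse; a minor identifies the two
    -- expansions, whence the factor 2.
    have h3 : 2 * ∑ a ∈ loZ n r, ∑ c ∈ lo n r, b a c.rev * b a.rev c = 0 := by
      rw [← h, two_mul (∑ a ∈ loZ n r, _), ← Finset.sum_add_distrib]
      refine Finset.sum_congr rfl fun a ha => ?_
      have haZ : a ∈ Z n r := (Finset.mem_filter.1 ha).1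
      have e1 := hM.middle a haZ a.rev (rev_mem_Z haZ)
      have e2 := hM.middle a.rev (rev_mem_Z haZ) a haZ
      rw [Fin.rev_rev] at e1
      rw [← e1, ← e2]
      congr 1
      exact Finset.sum_congr rfl fun c _ => by rw [hM.minor]; exact mul_comm _ _
    exact h2.mul_right_eq_zero.1 h3
  rw [Finset.sum_mul_sum]
  calc _ = ∑ a ∈ loZ n r, ∑ c ∈ lo n r, (b j s * b i t) * (b a c.rev * b a.rev c) := by
        refine Finset.sum_congr rfl fun a _ => Finset.sum_congr rfl fun c _ => ?_
        have e1 := hM.minor a j s c.rev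
        have e2 := hM.minor a.rev i t c
        linear_combination (b a.rev t * b i c) * e1 + b a c.rev * b j s * e2
    _ = 0 := by
        simp only [← Finset.mul_sum]
        rw [htr, mul_zero]

open MvPolynomial

variable {O : Type*} [CommRing O] [IsLocalRing O] {n r : ℕ}

local notation "κ" => IsLocalRing.ResidueField O

/-- The tautological matrix over the coordinate ring of the special fiber. -/
def fiberMatrix (π : O) (n r : ℕ) :
    Matrix (Fin (2 * n)) (Fin (2 * n)) (SpecialFiberRing π n r) :=
  Matrix.of fun i j => (1 : κ) ⊗ₜ[O]
    Ideal.Quotient.mk (idealNaive π n r ⊔ idealAdd π n r) (genX O n i j)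

theorem fromB_X (π : O) (p : Z n r × Zc n r) :
    fromB π n r (X p) = fiberMatrix π n r p.1 p.2 := by
  simp [fromB, fiberMatrix]

theorem algebraMap_uniformizer {T : Type*} [CommRing T] [Algebra O T] [Algebra κ T]
    [IsScalarTower O κ T] {π : O} (hπ : ¬ IsUnit π) : algebraMap O T π = 0 := by
  rw [IsScalarTower.algebraMap_apply O κ T, IsLocalRing.ResidueField.algebraMap_eq,
    (IsLocalRing.residue_eq_zero_iff π).2 ((IsLocalRing.mem_maximalIdeal π).2 hπ), map_zero]

theorem aeval_fiberMatrix (π : O) :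
    (aeval (R := O) fun p : Fin (2 * n) × Fin (2 * n) => fiberMatrix π n r p.1 p.2) =
      (Algebra.TensorProduct.includeRight : _ →ₐ[O] SpecialFiberRing π n r).comp
        (Ideal.Quotient.mkₐ O (idealNaive π n r ⊔ idealAdd π n r)) := by
  refine MvPolynomial.algHom_ext fun p => ?_
  simp [fiberMatrix, genX]

theorem isFiberPoint_fiberMatrix {π : O} (hπ : ¬ IsUnit π) :
    IsFiberPoint n r (fiberMatrix π n r) := by
  rw [isFiberPoint_iff π (algebraMap_uniformizer hπ), aeval_fiberMatrix]
  intro p hp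
  have : Ideal.Quotient.mk (idealNaive π n r ⊔ idealAdd π n r) p = 0 :=
    Ideal.Quotient.eq_zero_iff_mem.2 hp
  rw [RingHom.mem_ker, AlgHom.comp_apply, Ideal.Quotient.mkₐ_eq_mk, this, map_zero]

/-- A point of the special fiber over a `k`-algebra `T`. -/
theorem exists_algHom_of_isFiberPoint {T : Type*} [CommRing T] [Algebra O T] [Algebra κ T]
    [IsScalarTower O κ T] {π : O} (hπ : ¬ IsUnit π) (M : Matrix (Fin (2 * n)) (Fin (2 * n)) T)
    (hM : IsFiberPoint n r M) :
    ∃ f : SpecialFiberRing π n r →ₐ[κ] T, ∀ i j, f (fiberMatrix π n r i j) = M i j := by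
  rw [isFiberPoint_iff π (algebraMap_uniformizer hπ)] at hM
  refine ⟨Algebra.TensorProduct.lift (Algebra.ofId κ T) (Ideal.Quotient.liftₐ _
    (aeval (R := O) fun p : Fin (2 * n) × Fin (2 * n) => M p.1 p.2) fun p hp => hM hp)
    fun _ _ => Commute.all _ _, fun i j => ?_⟩
  have : Ideal.Quotient.liftₐ _ (aeval (R := O) fun p : Fin (2 * n) × Fin (2 * n) => M p.1 p.2)
    (fun p hp => hM hp) (Ideal.Quotient.mk (idealNaive π n r ⊔ idealAdd π n r) (genX O n i j)) =
      M i j := by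
    refine (Ideal.Quotient.lift_mk _ _ _).trans ?_
    simp [genX]
  rw [fiberMatrix, Matrix.of_apply, Algebra.TensorProduct.lift_tmul, this, map_one, one_mul]

/-- The image contains B, then A by `middle`, then the outer rows by solving `form₁`, whose linear
term has coefficient 2. -/
theorem fromB_surjective {π : O} (hπ : ¬ IsUnit π) (h2 : (2 : κ) ≠ 0) :
    Function.Surjective (fromB π n r) := by
  have hM := isFiberPoint_fiberMatrix (n := n) (r := r) hπ
  have hB : ∀ i ∈ Z n r, ∀ j ∉ Z n r, fiberMatrix π n r i j ∈ (fromB π n r).range := by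
    intro i hi j hj
    exact ⟨X (⟨i, hi⟩, ⟨j, Finset.mem_compl.2 hj⟩), fromB_X π _⟩
  have hA : ∀ i ∈ Z n r, ∀ j, fiberMatrix π n r i j ∈ (fromB π n r).range := by
    intro i hi j
    by_cases hj : j ∈ Z n r
    · have := hM.middle i hi j.rev (rev_mem_Z hj)
      rw [Fin.rev_rev] at this
      rw [← this]
      refine Subalgebra.sum_mem _ fun c hc => Subalgebra.mul_mem _ ?_ ?_
      · refine hB i hi _ (mt rev_mem_Z_iff.1 ?_)
        rw [mem_Z]; rw [mem_lo] at hc; omega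
      · refine hB _ (rev_mem_Z hj) _ ?_
        rw [mem_Z]; rw [mem_lo] at hc; omega
    · exact hB i hi j hj
  have hX : ∀ i j, fiberMatrix π n r i j ∈ (fromB π n r).range := by
    intro i j
    by_cases hi : i ∈ Z n r
    · exact hA i hi j
    · have := hM.form₁ i.rev j
      rw [if_neg (mt rev_mem_Z_iff.1 hi), Fin.rev_rev] at this
      have h3 : fiberMatrix π n r i j = (-(2 : κ)⁻¹) •
          ∑ a ∈ Z n r, fiberMatrix π n r a i.rev * fiberMatrix π n r a.rev j :=
        eq_smul_of_add_two_mul_eq_zero h2 this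
      rw [h3]
      refine Subalgebra.smul_mem _ (Subalgebra.sum_mem _ fun a ha => Subalgebra.mul_mem _ ?_ ?_) _
      · exact hA a ha _
      · exact hA _ (rev_mem_Z ha) _
  have hP : ∀ p : PolyX O n, aeval (R := O) (fun p : Fin (2 * n) × Fin (2 * n) =>
      fiberMatrix π n r p.1 p.2) p ∈ (fromB π n r).range := by
    intro p
    induction p using MvPolynomial.induction_on with
    | C c =>
      rw [← MvPolynomial.algebraMap_eq, AlgHom.commutes,
        IsScalarTower.algebraMap_apply O κ (SpecialFiberRing π n r)]
      exact Subalgebra.algebraMap_mem _ _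
    | add p q hp hq => rw [map_add]; exact Subalgebra.add_mem _ hp hq
    | mul_X p c hp =>
      rw [map_mul, aeval_X]
      exact Subalgebra.mul_mem _ hp (hX _ _)
  rw [← AlgHom.range_eq_top, eq_top_iff]
  intro x _
  induction x using TensorProduct.induction_on with
  | zero => exact Subalgebra.zero_mem _
  | add x y hx hy => exact Subalgebra.add_mem _ (hx trivial) (hy trivial)
  | tmul c y =>
    rw [show c ⊗ₜ[O] y = c • ((1 : κ) ⊗ₜ[O] y) by
      rw [TensorProduct.smul_tmul', smul_eq_mul, mul_one]]
    refine Subalgebra.smul_mem _ ?_ _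
    obtain ⟨p, rfl⟩ := Ideal.Quotient.mk_surjective y
    have := AlgHom.congr_fun (aeval_fiberMatrix (n := n) (r := r) π) p
    rw [AlgHom.comp_apply] at this
    change (1 : κ) ⊗ₜ[O] (Ideal.Quotient.mkₐ O (idealNaive π n r ⊔ idealAdd π n r) p) ∈ _
    rw [← Algebra.TensorProduct.includeRight_apply, ← this]
    exact hP p

/-- The lower half of `Z`, as a finset of elements of `Z`. -/
def halfZ (n r : ℕ) : Finset (Z n r) := Finset.univ.filter fun a => (a.1 : ℕ) < n

/-- The lower half of `Zᶜ`, as a finset of elements of `Zᶜ`. -/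
def halfZc (n r : ℕ) : Finset (Zc n r) := Finset.univ.filter fun a => (a.1 : ℕ) < n

theorem sum_halfZ {T : Type*} [AddCommMonoid T] (f : Fin (2 * n) → T) :
    ∑ a ∈ halfZ n r, f a = ∑ a ∈ loZ n r, f a := by
  rw [halfZ, Finset.sum_filter, Finset.sum_coe_sort (Z n r) fun a => if (a : ℕ) < n then f a else 0,
    ← Finset.sum_filter, loZ]

theorem sum_halfZc {T : Type*} [AddCommMonoid T] (f : Fin (2 * n) → T) :
    ∑ a ∈ halfZc n r, f a = ∑ a ∈ lo n r, f a := by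
  rw [halfZc, Finset.sum_filter,
    Finset.sum_coe_sort (Zc n r) fun a => if (a : ℕ) < n then f a else 0, ← Finset.sum_filter]
  refine Finset.sum_congr ?_ fun _ _ => rfl
  ext a
  simp only [Finset.mem_filter, mem_Zc, mem_lo]
  omega

/-- The polynomials vanishing on the special fiber vanish at the rank one matrices `u vᵗ` with
`q(u) q'(v) = 0`. -/
theorem ker_fromB_le_ker_rankOneHom {T : Type*} [CommRing T] [Algebra O T] [Algebra κ T]
    [IsScalarTower O κ T] {π : O} (hπ : ¬ IsUnit π) (u : Z n r → T) (v : Zc n r → T)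
    (h : quadForm (halfZ n r) revZ u * quadForm (halfZc n r) revZc v = 0) :
    RingHom.ker (fromB π n r) ≤
      RingHom.ker (rankOneHom (k := κ) (Equiv.refl (Z n r × Zc n r)) u v) := by
  -- Extension by zero; the rank one point uses u only on Z and v only on Zᶜ, so the default value
  -- is immaterial.
  let U : Fin (2 * n) → T := fun i => if h : i ∈ Z n r then u ⟨i, h⟩ else 0
  let V : Fin (2 * n) → T := fun i => if h : i ∈ Zc n r then v ⟨i, h⟩ else 0
  have hU : ∀ i : Z n r, U i = u i := fun i => dif_pos i.2
  have hV : ∀ i : Zc n r, V i = v i := fun i => dif_pos i.2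
  have hq : quadForm (halfZ n r) revZ u = ∑ a ∈ loZ n r, U a * U a.rev := by
    rw [← sum_halfZ]
    exact Finset.sum_congr rfl fun a _ => by rw [← hU, ← hU]; rfl
  have hq' : quadForm (halfZc n r) revZc v = ∑ a ∈ lo n r, V a * V a.rev := by
    rw [← sum_halfZc]
    exact Finset.sum_congr rfl fun a _ => by rw [← hV, ← hV]; rfl
  obtain ⟨f, hf⟩ := exists_algHom_of_isFiberPoint hπ _ (isFiberPoint_rankOne U V _ _ hq hq' h)
  have : f.comp (fromB π n r) = rankOneHom (k := κ) (Equiv.refl (Z n r × Zc n r)) u v := by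
    refine MvPolynomial.algHom_ext fun p => ?_
    have h1 := rankOneHom_genericMatrix (k := κ) (Equiv.refl (Z n r × Zc n r)) u v p.1 p.2
    simp only [genericMatrix, Matrix.of_apply, Equiv.refl_apply, Prod.mk.eta] at h1
    rw [AlgHom.comp_apply, fromB_X, hf, h1, Matrix.of_apply, if_pos p.1.2,
      if_neg (Finset.mem_compl.1 p.2.2), hU, hV]
  rw [← this]
  intro p hp
  rw [RingHom.mem_ker] at hp ⊢
  rw [AlgHom.comp_apply, hp, map_zero]

theorem minor_mem_ker {k T : Type*} [CommRing k] [CommRing T]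
    (f : PolyB k n r →+* T) {b : Matrix (Fin (2 * n)) (Fin (2 * n)) T}
    (hM : IsFiberPoint n r b) (hf : ∀ p, f (X p) = b p.1 p.2) (i t : Z n r) (j s : Zc n r) :
    f (genB k n r i j * genB k n r t s - genB k n r i s * genB k n r t j) = 0 := by
  simp only [map_sub, map_mul, genB, Matrix.of_apply, hf]
  exact sub_eq_zero.2 (hM.minor _ _ _ _)

/-- The products of the equations of the two quadrics vanish on the special fiber. -/
theorem quad_mul_quad_mem_ker {k T : Type*} [CommRing k] [CommRing T]
    (f : PolyB k n r →+* T) {b : Matrix (Fin (2 * n)) (Fin (2 * n)) T}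
    (hM : IsFiberPoint n r b) (hf : ∀ p, f (X p) = b p.1 p.2) (h2 : IsUnit (2 : T)) (i j : Z n r)
    (s t : Zc n r) :
    f ((∑ a ∈ halfZ n r, genB k n r a s * genB k n r (revZ a) t) *
      (∑ c ∈ halfZc n r, genB k n r i c * genB k n r j (revZc c))) = 0 := by
  simp only [map_mul, map_sum, genB, Matrix.of_apply, hf, revZ, revZc]
  rw [sum_halfZ fun a => b a s * b a.rev t, sum_halfZc fun c => b i c * b j c.rev]
  exact hM.quad_mul_quad h2 i j s t

theorem fromB_minor {π : O} (hπ : ¬ IsUnit π) (i t : Z n r) (j s : Zc n r) :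
    genB κ n r i j * genB κ n r t s - genB κ n r i s * genB κ n r t j ∈
      RingHom.ker (fromB π n r) :=
  RingHom.mem_ker.2 <| minor_mem_ker (k := κ) (fromB π n r).toRingHom (isFiberPoint_fiberMatrix hπ) (fromB_X π) i t j s

theorem fromB_quad_mul_quad {π : O} (hπ : ¬ IsUnit π) (h2 : (2 : κ) ≠ 0) (i j : Z n r)
    (s t : Zc n r) :
    (∑ a ∈ halfZ n r, genB κ n r a s * genB κ n r (revZ a) t) *
      (∑ c ∈ halfZc n r, genB κ n r i c * genB κ n r j (revZc c)) ∈
      RingHom.ker (fromB π n r) :=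
  RingHom.mem_ker.2 <| quad_mul_quad_mem_ker (k := κ) (fromB π n r).toRingHom (isFiberPoint_fiberMatrix hπ) (fromB_X π)
    (isUnit_two_of_algebra h2) i j s t

end Fiber

/-! ### Irreducible components of a closed subscheme -/

section Components

variable {P S : Type*} [CommRing P] [CommRing S]

theorem topologicalKrullDim_zeroLocus (J : Ideal S) :
    topologicalKrullDim (PrimeSpectrum.zeroLocus (J : Set S)) = ringKrullDim (S ⧸ J) := by
  have hs : Function.Surjective (Ideal.Quotient.mk J) := Ideal.Quotient.mk_surjective
  have he := PrimeSpectrum.isClosedEmbedding_comap_of_surjective _ (Ideal.Quotient.mk J) hs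
  have hr : Set.range (PrimeSpectrum.comap (Ideal.Quotient.mk J)) =
      PrimeSpectrum.zeroLocus (J : Set S) := by
    rw [range_comap_of_surjective _ _ hs, Ideal.mk_ker]
  rw [← PrimeSpectrum.topologicalKrullDim_eq_ringKrullDim, ← hr]
  exact (he.isEmbedding.toHomeomorph.isHomeomorph.topologicalKrullDim_eq).symm

theorem comap_map_eq_of_ker_le {f : P →+* S} (hf : Function.Surjective f)
    {I : Ideal P} (hI : RingHom.ker f ≤ I) :
    (I.map f).comap f = I := by
  rw [Ideal.comap_map_of_surjective' f hf, sup_eq_left.2 hI]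

/-- As I contains the kernel, the quotient of S by the image of I is P/I. -/
theorem topologicalKrullDim_zeroLocus_image {f : P →+* S} (hf : Function.Surjective f)
    {I : Ideal P} (hI : RingHom.ker f ≤ I) :
    topologicalKrullDim (PrimeSpectrum.zeroLocus (f '' (I : Set P))) = ringKrullDim (P ⧸ I) := by
  rw [← PrimeSpectrum.zeroLocus_span, ← Ideal.map, topologicalKrullDim_zeroLocus]
  have hs : Function.Surjective ((Ideal.Quotient.mk (I.map f)).comp f) :=
    Ideal.Quotient.mk_surjective.comp hf
  have hk : RingHom.ker ((Ideal.Quotient.mk (I.map f)).comp f) = I := by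
    rw [← RingHom.comap_ker, Ideal.mk_ker, comap_map_eq_of_ker_le hf hI]
  exact (ringKrullDim_eq_of_ringEquiv ((Ideal.quotEquivOfEq hk.symm).trans
    (RingHom.quotientKerEquivOfSurjective hs))).symm

/-- If the primes `I c` contain the kernel of the surjection `f`, are pairwise incomparable, and
each prime containing the kernel contains one of them, their images are the minimal primes. -/
theorem minimalPrimes_eq_range_map {f : P →+* S} (hf : Function.Surjective f) {ι : Type*}
    {I : ι → Ideal P} (hker : ∀ c, RingHom.ker f ≤ I c) (hprime : ∀ c, (I c).IsPrime)
    (hcover : ∀ Q : Ideal P, Q.IsPrime → RingHom.ker f ≤ Q → ∃ c, I c ≤ Q)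
    (hanti : ∀ c c', I c ≤ I c' → c = c') :
    minimalPrimes S = Set.range fun c => (I c).map f := by
  have hp : ∀ c, ((I c).map f).IsPrime := fun c =>
    have := hprime c
    Ideal.map_isPrime_of_surjective hf (hker c)
  have h1 : ∀ q : Ideal S, q.IsPrime → ∃ c, (I c).map f ≤ q := by
    intro q hq
    obtain ⟨c, hc⟩ := hcover (q.comap f) (hq.comap f)
      (fun x hx => by rw [Ideal.mem_comap, RingHom.mem_ker.1 hx]; exact zero_mem _)
    exact ⟨c, Ideal.map_le_iff_le_comap.2 hc⟩
  have h2 : ∀ q ∈ minimalPrimes S, ∃ c, (I c).map f = q := by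
    intro q hq
    obtain ⟨c, hc⟩ := h1 q hq.1.1
    exact ⟨c, le_antisymm hc (hq.2 ⟨hp c, bot_le⟩ hc)⟩
  ext q
  constructor
  · exact h2 q
  · rintro ⟨c, rfl⟩
    have := hp c
    -- A minimal prime below the image of `I c` is itself the image of some `I c'`, and
    -- incomparability gives c' = c.
    obtain ⟨q, hq, hqc⟩ := Ideal.exists_minimalPrimes_le (J := (I c).map f) bot_le
    obtain ⟨c', rfl⟩ := h2 q hq
    have h3 := Ideal.comap_mono (f := f) hqc
    rw [comap_map_eq_of_ker_le hf (hker c), comap_map_eq_of_ker_le hf (hker c')] at h3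
    rw [← hanti _ _ h3]
    exact hq

theorem range_zeroLocus_eq_irreducibleComponents {f : P →+* S} (hf : Function.Surjective f) {ι : Type*}
    {I : ι → Ideal P} (hker : ∀ c, RingHom.ker f ≤ I c) (hprime : ∀ c, (I c).IsPrime)
    (hcover : ∀ Q : Ideal P, Q.IsPrime → RingHom.ker f ≤ Q → ∃ c, I c ≤ Q)
    (hanti : ∀ c c', I c ≤ I c' → c = c') :
    (Set.range fun c => PrimeSpectrum.zeroLocus (f '' (I c : Set P))) =
      irreducibleComponents (PrimeSpectrum S) := by
  rw [← PrimeSpectrum.zeroLocus_minimalPrimes,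
    minimalPrimes_eq_range_map hf hker hprime hcover hanti, ← Set.range_comp]
  congr 1
  funext c
  rw [← PrimeSpectrum.zeroLocus_span]
  rfl

theorem zeroLocus_image_injective {f : P →+* S} (hf : Function.Surjective f) {ι : Type*}
    {I : ι → Ideal P} (hker : ∀ c, RingHom.ker f ≤ I c) (hprime : ∀ c, (I c).IsPrime)
    (hanti : ∀ c c', I c ≤ I c' → c = c') :
    Function.Injective fun c => PrimeSpectrum.zeroLocus (f '' (I c : Set P)) := by
  intro c c' h
  have hp : ∀ c, ((I c).map f).IsPrime := fun c =>
    have := hprime c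
    Ideal.map_isPrime_of_surjective hf (hker c)
  simp only at h
  rw [← PrimeSpectrum.zeroLocus_span (f '' (I c : Set P)),
    ← PrimeSpectrum.zeroLocus_span (f '' (I c' : Set P)), ← Ideal.map, ← Ideal.map,
    PrimeSpectrum.zeroLocus_eq_iff, (hp c).radical, (hp c').radical] at h
  refine hanti _ _ (le_of_eq ?_)
  rw [← comap_map_eq_of_ker_le hf (hker c), h, comap_map_eq_of_ker_le hf (hker c')]

end Components

/-! ### Comparison of the ideals of rank one matrices -/

section Compare

open MvPolynomial

/-- `L` contains exactly one element of each orbit of the fixed point free involution `τ`. -/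
structure IsHalf {α : Type*} (L : Finset α) (τ : α → α) : Prop where
  involutive : Function.Involutive τ
  mem_iff : ∀ a, τ a ∈ L ↔ a ∉ L

variable {k : Type*} [Field k] {α β σ : Type*} {L : Finset α} {τ : α → α}

theorem IsHalf.apply_notMem (h : IsHalf L τ) (a : α) (ha : a ∈ L) : τ a ∉ L := fun h' =>
  (h.mem_iff a).1 h' ha

theorem IsHalf.injOn (h : IsHalf L τ) : Set.InjOn τ L := h.involutive.injective.injOn

theorem IsHalf.apply_ne (h : IsHalf L τ) (a : α) : τ a ≠ a := fun h' => by
  have := h.mem_iff a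
  rw [h'] at this
  tauto

theorem IsHalf.quadForm_single [DecidableEq α] (h : IsHalf L τ) (a : α) :
    quadForm L τ (fun i => if i = a then (1 : k) else 0) = 0 := by
  refine Finset.sum_eq_zero fun b _ => ?_
  by_cases hb : b = a
  · simp [hb, h.apply_ne a]
  · simp [hb]

theorem IsHalf.quadForm_pair [DecidableEq α] (h : IsHalf L τ) {a : α} (ha : a ∈ L) :
    quadForm L τ (fun i => if i = a ∨ i = τ a then (1 : k) else 0) = 1 := by
  rw [quadForm, Finset.sum_eq_single a]
  · simp
  · intro b hb hba
    have : ¬ (b = a ∨ b = τ a) := by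
      rintro (h' | h')
      · exact hba h'
      · exact h.apply_notMem a ha (h' ▸ hb)
    rw [if_neg this, zero_mul]
  · exact fun h' => (h' ha).elim

/-- Exchange of rows and columns. -/
def swapEquiv (e : α × β ≃ σ) : β × α ≃ σ := (Equiv.prodComm β α).trans e

theorem genericMatrix_swapEquiv (e : α × β ≃ σ) (i : α) (j : β) :
    genericMatrix k (swapEquiv e) j i = genericMatrix k e i j := rfl

theorem rankOneHom_swapEquiv {R : Type*} [CommRing R] [Algebra k R] (e : α × β ≃ σ)
    (u : α → R) (v : β → R) : rankOneHom (k := k) (swapEquiv e) v u = rankOneHom e u v := by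
  refine MvPolynomial.algHom_ext fun c => ?_
  simp [rankOneHom, swapEquiv, mul_comm]

/-- The tautological rank one matrix over `k[u, v]/(q)`. -/
theorem ker_rankOneHom_generic (e : α × β ≃ σ) (L : Finset α) (τ : α → α) :
    RingHom.ker (rankOneHom (k := k) e
      (fun a => Ideal.Quotient.mk (Ideal.span {quadPoly k β L τ}) (X (Sum.inl a)))
      (fun b => Ideal.Quotient.mk (Ideal.span {quadPoly k β L τ}) (X (Sum.inr b)))) =
      quadIdeal (genericMatrix k e) L τ := by
  rw [← comap_segre_eq_quadIdeal]
  have : rankOneHom (k := k) e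
      (fun a => Ideal.Quotient.mk (Ideal.span {quadPoly k β L τ}) (X (Sum.inl a)))
      (fun b => Ideal.Quotient.mk (Ideal.span {quadPoly k β L τ}) (X (Sum.inr b))) =
      (Ideal.Quotient.mkₐ k (Ideal.span {quadPoly k β L τ})).comp (segre k e) := by
    refine MvPolynomial.algHom_ext fun c => ?_
    simp [rankOneHom, segre]
  rw [this]
  ext p
  rw [RingHom.mem_ker, AlgHom.comp_apply, Ideal.Quotient.mkₐ_eq_mk, Ideal.Quotient.eq_zero_iff_mem,
    Ideal.mem_comap]

theorem map_quadForm {R S : Type*} [CommRing R] [CommRing S] (f : R →+* S) (L : Finset α)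
    (τ : α → α) (u : α → R) : f (quadForm L τ u) = quadForm L τ fun a => f (u a) := by
  simp [quadForm]

theorem quadForm_generic (β : Type*) (L : Finset α) (τ : α → α) :
    quadForm L τ (fun a => Ideal.Quotient.mk (Ideal.span {quadPoly k β L τ}) (X (Sum.inl a))) =
      0 := by
  refine (map_quadForm (Ideal.Quotient.mk _) L τ _).symm.trans ?_
  exact Ideal.Quotient.eq_zero_iff_mem.2 (Ideal.mem_span_singleton_self _)

variable {L' : Finset β} {τ' : β → β}

/-- Witness u vᵗ with u = e_a + e_{τ a}, for which q(u) = 1, and v = e_b, which is isotropic. -/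
theorem not_quadIdeal_le_quadIdeal_swap (e : α × β ≃ σ) (h : IsHalf L τ) (h' : IsHalf L' τ')
    {a : α} (ha : a ∈ L) (b : β) :
    ¬ quadIdeal (genericMatrix k e) L τ ≤ quadIdeal (genericMatrix k (swapEquiv e)) L' τ' := by
  classical
  intro hle
  have h1 := quadIdeal_le_ker_rankOneHom (k := k) (swapEquiv e) L' τ' _
    (fun i => if i = a ∨ i = τ a then (1 : k) else 0) (h'.quadForm_single b)
  rw [rankOneHom_swapEquiv] at h1
  refine not_quadIdeal_le_ker_rankOneHom (k := k) e L τ _ _ ?_ b ?_ (hle.trans h1)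
  · rw [h.quadForm_pair ha]; exact one_ne_zero
  · simp

/-- The polynomials in the entries of the row `i`. -/
def rowIdeal (k : Type*) [Field k] (e : α × β ≃ σ) (i : α) : Ideal (MvPolynomial σ k) :=
  Ideal.span {f | ∃ j, f = genericMatrix k e i j}

theorem rowIdeal_le_ker_rankOneHom (e : α × β ≃ σ) {i : α} {u : α → k} (hu : u i = 0)
    (v : β → k) : rowIdeal k e i ≤ RingHom.ker (rankOneHom (k := k) e u v) := by
  refine Ideal.span_le.2 ?_
  rintro f ⟨j, rfl⟩
  refine RingHom.mem_ker.2 ?_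
  rw [rankOneHom_genericMatrix, hu, zero_mul]

theorem not_rowIdeal_le_rowIdeal (e : α × β ≃ σ) {i i' : α} (h : i ≠ i') (b : β) :
    ¬ rowIdeal k e i ≤ rowIdeal k e i' := by
  classical
  intro hle
  have h1 := hle.trans (rowIdeal_le_ker_rankOneHom (k := k) e
    (u := fun j => if j = i' then 0 else 1) (if_pos rfl) (fun _ => 1))
  have h2 := h1 (Ideal.subset_span ⟨b, rfl⟩)
  rw [RingHom.mem_ker, rankOneHom_genericMatrix, if_neg h] at h2
  simp at h2

/-- Witness u vᵗ with u zero exactly at i' and v = e_b + e_{τ' b}, for which q'(v) = 1. -/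
theorem not_quadIdeal_swap_le_rowIdeal (e : α × β ≃ σ) (h' : IsHalf L' τ') {b : β} (hb : b ∈ L')
    {i i' : α} (h : i ≠ i') :
    ¬ quadIdeal (genericMatrix k (swapEquiv e)) L' τ' ≤ rowIdeal k e i' := by
  classical
  intro hle
  have h1 := hle.trans (rowIdeal_le_ker_rankOneHom (k := k) e
    (u := fun j => if j = i' then 0 else 1) (if_pos rfl)
    (fun j => if j = b ∨ j = τ' b then (1 : k) else 0))
  rw [← rankOneHom_swapEquiv] at h1
  refine not_quadIdeal_le_ker_rankOneHom (k := k) (swapEquiv e) L' τ' _ _ ?_ i ?_ h1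
  · rw [h'.quadForm_pair hb]; exact one_ne_zero
  · simp [h]

theorem quadIdeal_le_rowIdeal [DecidableEq α] (e : α × β ≃ σ) {i₀ i₁ : α} (h : i₀ ≠ i₁)
    (hα : ∀ i, i = i₀ ∨ i = i₁)
    (hq : quadForm L τ (fun i => if i = i₀ then (0 : MvPolynomial β k) else 1) = 0) :
    quadIdeal (genericMatrix k e) L τ ≤ rowIdeal k e i₀ := by
  rw [rowIdeal, ← ker_rankOneHom_of_two_rows e i₀ i₁ h hα]
  exact quadIdeal_le_ker_rankOneHom e L τ _ _ hq

theorem quadForm_two_rows [DecidableEq α] {a i : α} (hL : L = {a})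
    (hi : i = a ∨ i = τ a) (R : Type*) [CommRing R] :
    quadForm L τ (fun j => if j = i then (0 : R) else 1) = 0 := by
  rw [quadForm, hL, Finset.sum_singleton]
  rcases hi with rfl | rfl
  · simp
  · simp

/-- With one hyperbolic plane each quadratic generator is a product x_{a s} x_{τ a, t}; if neither
row lay in Q, a product of two entries outside Q would lie in it. -/
theorem rowIdeal_le_or_of_quadIdeal_le (e : α × β ≃ σ) {a : α} (hL : L = {a})
    {Q : Ideal (MvPolynomial σ k)} (hQ : Q.IsPrime)
    (h : quadIdeal (genericMatrix k e) L τ ≤ Q) :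
    rowIdeal k e a ≤ Q ∨ rowIdeal k e (τ a) ≤ Q := by
  by_contra hcon
  push Not at hcon
  obtain ⟨h1, h2⟩ := hcon
  simp only [rowIdeal, Ideal.span_le, Set.not_subset] at h1 h2
  obtain ⟨f, ⟨s, rfl⟩, hs⟩ := h1
  obtain ⟨g, ⟨t, rfl⟩, ht⟩ := h2
  have h3 := h (Ideal.subset_span (Or.inl ⟨s, t, rfl⟩))
  rw [hL, Finset.sum_singleton] at h3
  exact (hQ.mem_or_mem h3).elim hs ht

/-- As soon as one equation of the first quadric is outside the prime Q, every equation of the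
second is inside. -/
theorem quadIdeal_le_or_of_mul_mem (e : α × β ≃ σ) {Q : Ideal (MvPolynomial σ k)}
    (hQ : Q.IsPrime) (hminor : minors (genericMatrix k e) ⊆ Q)
    (hmul : ∀ (s t : β) (i j : α),
      (∑ a ∈ L, genericMatrix k e a s * genericMatrix k e (τ a) t) *
        (∑ c ∈ L', genericMatrix k e i c * genericMatrix k e j (τ' c)) ∈ Q) :
    quadIdeal (genericMatrix k e) L τ ≤ Q ∨
      quadIdeal (genericMatrix k (swapEquiv e)) L' τ' ≤ Q := by
  by_cases h1 : ∀ s t, ∑ a ∈ L, genericMatrix k e a s * genericMatrix k e (τ a) t ∈ Q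
  · left
    refine Ideal.span_le.2 (Set.union_subset ?_ hminor)
    rintro f ⟨s, t, rfl⟩
    exact h1 s t
  · right
    push Not at h1
    obtain ⟨s, t, hst⟩ := h1
    refine Ideal.span_le.2 (Set.union_subset ?_ ?_)
    · rintro f ⟨i, j, rfl⟩
      exact (hQ.mem_or_mem (hmul s t i j)).resolve_left hst
    · rintro f ⟨i, t, j, s, rfl⟩
      simp only [genericMatrix_swapEquiv]
      refine hminor ⟨j, s, i, t, ?_⟩
      ring

end Compare

/-! ### The listed ideals as quadric and row ideals. -/

section Chart

open MvPolynomial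

variable {n r : ℕ}

theorem isHalf_halfZ : IsHalf (halfZ n r) revZ where
  involutive a := Subtype.ext (Fin.rev_rev _)
  mem_iff a := by
    have := a.2
    simp only [halfZ, Finset.mem_filter, Finset.mem_univ, true_and, revZ, Fin.val_rev]
    omega

theorem isHalf_halfZc : IsHalf (halfZc n r) revZc where
  involutive a := Subtype.ext (Fin.rev_rev _)
  mem_iff a := by
    simp only [halfZc, Finset.mem_filter, Finset.mem_univ, true_and, revZc, Fin.val_rev]
    omega

theorem card_Z (h : r ≤ n) : Nat.card (Z n r) = 2 * r := by
  rw [Nat.card_eq_fintype_card, Fintype.card_coe]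
  have : (Z n r).map Fin.valEmbedding = Finset.Ico (n - r) (n + r) := by
    ext i
    simp only [Finset.mem_map, mem_Z, Fin.valEmbedding_apply, Finset.mem_Ico]
    constructor
    · rintro ⟨a, ha, rfl⟩; omega
    · intro hi; exact ⟨⟨i, by omega⟩, by simp only; omega, rfl⟩
  rw [← Finset.card_map Fin.valEmbedding, this, Nat.card_Ico]
  omega

theorem card_Zc (h : r ≤ n) : Nat.card (Zc n r) = 2 * n - 2 * r := by
  have h1 := card_Z h
  rw [Nat.card_eq_fintype_card, Fintype.card_coe] at h1 ⊢
  rw [Zc, Finset.card_compl, Fintype.card_fin, h1]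

variable (k : Type*) [Field k]

theorem idealMid₁_eq : idealMid₁ k n r =
    quadIdeal (genericMatrix k (Equiv.refl (Z n r × Zc n r))) (halfZ n r) revZ := by
  have : {f : PolyB k n r | ∃ t s, f = ∑ a : Z n r with (a.1 : ℕ) < n,
      genB k n r (revZ a) (revZc t) * genB k n r a s} =
      {f | ∃ s t, f = ∑ a ∈ halfZ n r, genericMatrix k (Equiv.refl (Z n r × Zc n r)) a s *
        genericMatrix k (Equiv.refl (Z n r × Zc n r)) (revZ a) t} := by
    ext f
    constructor
    · rintro ⟨t, s, rfl⟩
      -- The reversal in the listed generators only permutes the column indices.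
      exact ⟨s, revZc t, Finset.sum_congr rfl fun a _ => mul_comm _ _⟩
    · rintro ⟨s, t, rfl⟩
      refine ⟨revZc t, s, Finset.sum_congr rfl fun a _ => ?_⟩
      rw [isHalf_halfZc.involutive t]
      exact mul_comm _ _
  exact congrArg Ideal.span (congrArg₂ _ this rfl)

theorem minors_genericMatrix_swap {α β σ : Type*} (e : α × β ≃ σ) :
    minors (genericMatrix k (swapEquiv e)) = minors (genericMatrix k e) := by
  ext f
  constructor
  · rintro ⟨i, t, j, s, rfl⟩
    refine ⟨j, s, i, t, ?_⟩
    simp only [genericMatrix_swapEquiv]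
    ring
  · rintro ⟨i, t, j, s, rfl⟩
    refine ⟨j, s, i, t, ?_⟩
    simp only [genericMatrix_swapEquiv]
    ring

theorem idealMid₂_eq : idealMid₂ k n r =
    quadIdeal (genericMatrix k (swapEquiv (Equiv.refl (Z n r × Zc n r)))) (halfZc n r) revZc := by
  have : {f : PolyB k n r | ∃ i j, f = ∑ a : Zc n r with (a.1 : ℕ) < n,
      genB k n r i a * genB k n r (revZ j) (revZc a)} =
      {f | ∃ s t, f = ∑ a ∈ halfZc n r,
        genericMatrix k (swapEquiv (Equiv.refl (Z n r × Zc n r))) a s *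
        genericMatrix k (swapEquiv (Equiv.refl (Z n r × Zc n r))) (revZc a) t} := by
    ext f
    constructor
    · rintro ⟨i, j, rfl⟩
      exact ⟨i, revZ j, rfl⟩
    · rintro ⟨s, t, rfl⟩
      refine ⟨s, revZ t, Finset.sum_congr rfl fun a _ => ?_⟩
      rw [isHalf_halfZ.involutive t]
      rfl
  refine congrArg Ideal.span (congrArg₂ _ this ?_)
  rw [minors_genericMatrix_swap]
  rfl

/-- By symmetry, it suffices to impose the quadratic equations for `s ≤ t`. -/
theorem span_le_eq_quadIdeal {R α β : Type*} [CommRing R] [LinearOrder β] (x : Matrix α β R)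
    (L : Finset α) (τ : α → α) :
    Ideal.span ({f | ∃ s t, s ≤ t ∧ f = ∑ a ∈ L, x a s * x (τ a) t} ∪ minors x) =
      quadIdeal x L τ := by
  apply le_antisymm
  · refine Ideal.span_mono (Set.union_subset_union_left _ ?_)
    rintro f ⟨s, t, -, rfl⟩
    exact ⟨s, t, rfl⟩
  · refine Ideal.span_le.2 (Set.union_subset ?_ fun f hf => Ideal.subset_span (Or.inr hf))
    rintro f ⟨s, t, rfl⟩
    rcases le_total s t with h | h
    · exact Ideal.subset_span (Or.inl ⟨s, t, h, rfl⟩)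
    -- Exchanging s and t changes each term by a minor.
    · have e : ∑ a ∈ L, x a s * x (τ a) t = ∑ a ∈ L, x a t * x (τ a) s +
          ∑ a ∈ L, (x a s * x (τ a) t - x a t * x (τ a) s) := by
        rw [← Finset.sum_add_distrib]
        exact Finset.sum_congr rfl fun a _ => by ring
      rw [e]
      refine Ideal.add_mem _ (Ideal.subset_span (Or.inl ⟨t, s, h, rfl⟩)) (Ideal.sum_mem _ ?_)
      exact fun a _ => Ideal.subset_span (Or.inr ⟨a, τ a, s, t, rfl⟩)

theorem idealLow₃_eq : idealLow₃ k n r =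
    quadIdeal (genericMatrix k (swapEquiv (Equiv.refl (Z n r × Zc n r)))) (halfZc n r) revZc := by
  rw [← span_le_eq_quadIdeal, minors_genericMatrix_swap]
  rfl

theorem idealHigh₃_eq : idealHigh₃ k n r =
    quadIdeal (genericMatrix k (Equiv.refl (Z n r × Zc n r))) (halfZ n r) revZ := by
  rw [← span_le_eq_quadIdeal]
  rfl

theorem idealLow₁_eq (i₀ : Z n r) (h : (i₀.1 : ℕ) + 1 = n) :
    idealLow₁ k n r = rowIdeal k (Equiv.refl (Z n r × Zc n r)) i₀ := by
  refine congrArg Ideal.span (Set.ext fun f => ⟨?_, ?_⟩)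
  · rintro ⟨i, j, hi, rfl⟩
    obtain rfl : i = i₀ := Subtype.ext (Fin.ext (by omega))
    exact ⟨j, rfl⟩
  · rintro ⟨j, rfl⟩
    exact ⟨i₀, j, h, rfl⟩

theorem idealLow₂_eq (i₀ : Z n r) (h : (i₀.1 : ℕ) = n) :
    idealLow₂ k n r = rowIdeal k (Equiv.refl (Z n r × Zc n r)) i₀ := by
  refine congrArg Ideal.span (Set.ext fun f => ⟨?_, ?_⟩)
  · rintro ⟨i, j, hi, rfl⟩
    obtain rfl : i = i₀ := Subtype.ext (Fin.ext (by omega))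
    exact ⟨j, rfl⟩
  · rintro ⟨j, rfl⟩
    exact ⟨i₀, j, h, rfl⟩

theorem idealHigh₁_eq (j₀ : Zc n r) (h : (j₀.1 : ℕ) = 0) :
    idealHigh₁ k n r = rowIdeal k (swapEquiv (Equiv.refl (Z n r × Zc n r))) j₀ := by
  refine congrArg Ideal.span (Set.ext fun f => ⟨?_, ?_⟩)
  · rintro ⟨i, j, hj, rfl⟩
    obtain rfl : j = j₀ := Subtype.ext (Fin.ext (by omega))
    exact ⟨i, rfl⟩
  · rintro ⟨i, rfl⟩
    exact ⟨i, j₀, h, rfl⟩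

theorem idealHigh₂_eq (j₀ : Zc n r) (h : (j₀.1 : ℕ) + 1 = 2 * n) :
    idealHigh₂ k n r = rowIdeal k (swapEquiv (Equiv.refl (Z n r × Zc n r))) j₀ := by
  refine congrArg Ideal.span (Set.ext fun f => ⟨?_, ?_⟩)
  · rintro ⟨i, j, hj, rfl⟩
    obtain rfl : j = j₀ := Subtype.ext (Fin.ext (by omega))
    exact ⟨i, rfl⟩
  · rintro ⟨i, rfl⟩
    exact ⟨i, j₀, h, rfl⟩

end Chart

/-! ### Transfer from ideals of k[B₁|B₂] to the special fiber. -/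

section Fiber

open MvPolynomial

variable {O : Type*} [CommRing O] [IsLocalRing O] {n r : ℕ} {π : O}

local notation "κ" => IsLocalRing.ResidueField O
local notation "ε" => Equiv.refl (Z n r × Zc n r)

/-- Passes to a plain ring homomorphism with the same values, the form in which the general results
on components are stated. -/
theorem exists_ringHom_eq_fromB (π : O) (n r : ℕ) :
    ∃ f : PolyB κ n r →+* SpecialFiberRing π n r, ∀ x, f x = fromB π n r x :=
  ⟨(fromB π n r).toRingHom, fun _ => rfl⟩

theorem ker_le_of_eq_fromB {f : PolyB κ n r →+* SpecialFiberRing π n r}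
    (hf : ∀ x, f x = fromB π n r x) {I : Ideal (PolyB κ n r)}
    (h : RingHom.ker (fromB π n r) ≤ I) : RingHom.ker f ≤ I := fun x hx =>
  h (RingHom.mem_ker.2 ((hf x).symm.trans (RingHom.mem_ker.1 hx)))

theorem ker_fromB_le_of_eq_fromB {f : PolyB κ n r →+* SpecialFiberRing π n r}
    (hf : ∀ x, f x = fromB π n r x) {I : Ideal (PolyB κ n r)}
    (h : RingHom.ker f ≤ I) : RingHom.ker (fromB π n r) ≤ I := fun x hx =>
  h (RingHom.mem_ker.2 ((hf x).trans (RingHom.mem_ker.1 hx)))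

theorem zeroLocus_image_eq_locus {f : PolyB κ n r →+* SpecialFiberRing π n r}
    (hf : ∀ x, f x = fromB π n r x) (I : Ideal (PolyB κ n r)) :
    PrimeSpectrum.zeroLocus (f '' (I : Set (PolyB κ n r))) = locus π n r I :=
  congrArg PrimeSpectrum.zeroLocus (Set.image_congr fun x _ => hf x)

theorem topologicalKrullDim_locus (hs : Function.Surjective (fromB π n r))
    {I : Ideal (PolyB κ n r)} (hker : RingHom.ker (fromB π n r) ≤ I) :
    topologicalKrullDim (locus π n r I) = ringKrullDim (PolyB κ n r ⧸ I) := by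
  obtain ⟨f, hf⟩ := exists_ringHom_eq_fromB π n r
  have hfs : Function.Surjective f := by rwa [show ⇑f = fromB π n r from funext hf]
  have e := topologicalKrullDim_zeroLocus_image (P := PolyB κ n r)
    (S := SpecialFiberRing π n r) (f := f) hfs (I := I) (ker_le_of_eq_fromB hf hker)
  rwa [zeroLocus_image_eq_locus hf] at e

theorem locus_injective (hs : Function.Surjective (fromB π n r)) {m : ℕ}
    {I : Fin m → Ideal (PolyB κ n r)} (hker : ∀ c, RingHom.ker (fromB π n r) ≤ I c)
    (hprime : ∀ c, (I c).IsPrime) (hanti : ∀ c c', I c ≤ I c' → c = c') :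
    Function.Injective fun c => locus π n r (I c) := by
  obtain ⟨f, hf⟩ := exists_ringHom_eq_fromB π n r
  have hfs : Function.Surjective f := by rwa [show ⇑f = fromB π n r from funext hf]
  have e := zeroLocus_image_injective (P := PolyB κ n r) (S := SpecialFiberRing π n r) (f := f)
    hfs (ι := Fin m) (I := I) (fun c => ker_le_of_eq_fromB hf (hker c)) hprime hanti
  simpa only [zeroLocus_image_eq_locus hf] using e

theorem range_locus (hs : Function.Surjective (fromB π n r)) {m : ℕ}
    {I : Fin m → Ideal (PolyB κ n r)} (hker : ∀ c, RingHom.ker (fromB π n r) ≤ I c)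
    (hprime : ∀ c, (I c).IsPrime)
    (hcover : ∀ Q : Ideal (PolyB κ n r), Q.IsPrime → RingHom.ker (fromB π n r) ≤ Q → ∃ c, I c ≤ Q)
    (hanti : ∀ c c', I c ≤ I c' → c = c') :
    (Set.range fun c => locus π n r (I c)) = irreducibleComponents (SpecialFiber π n r) := by
  obtain ⟨f, hf⟩ := exists_ringHom_eq_fromB π n r
  have hfs : Function.Surjective f := by rwa [show ⇑f = fromB π n r from funext hf]
  have e := range_zeroLocus_eq_irreducibleComponents (P := PolyB κ n r)
    (S := SpecialFiberRing π n r) (f := f) hfs (ι := Fin m) (I := I)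
    (fun c => ker_le_of_eq_fromB hf (hker c)) hprime
    (fun Q hQ h => hcover Q hQ (ker_fromB_le_of_eq_fromB hf h)) hanti
  simpa only [zeroLocus_image_eq_locus hf] using e

theorem DefineComponents.of_prime_cover (hs : Function.Surjective (fromB π n r)) {m : ℕ}
    {I : Fin m → Ideal (PolyB κ n r)} (hker : ∀ c, RingHom.ker (fromB π n r) ≤ I c)
    (hprime : ∀ c, (I c).IsPrime)
    (hcover : ∀ Q : Ideal (PolyB κ n r), Q.IsPrime → RingHom.ker (fromB π n r) ≤ Q → ∃ c, I c ≤ Q)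
    (hanti : ∀ c c', I c ≤ I c' → c = c')
    (hdim : ∀ c, ringKrullDim (PolyB κ n r ⧸ I c) = ((2 * n - 2 : ℕ) : WithBot ℕ∞)) :
    DefineComponents π n r I :=
  ⟨hs, hker, locus_injective hs hker hprime hanti, range_locus hs hker hprime hcover hanti,
    fun c => (topologicalKrullDim_locus hs (hker c)).trans (hdim c), hprime⟩

theorem DefineComponents.ncard {m : ℕ} {I : Fin m → Ideal (PolyB κ n r)}
    (h : DefineComponents π n r I) :
    (irreducibleComponents (SpecialFiber π n r)).ncard = m := by
  rw [← h.range_eq, ← Set.image_univ, Set.ncard_image_of_injective _ h.injective, Set.ncard_univ,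
    Nat.card_fin]

/-- The tautological vectors over k[u, v]/(q) satisfy q(u) q'(v) = 0, and evaluation at their
product has exactly this ideal as kernel. -/
theorem ker_fromB_le_quadIdeal (hπ : ¬ IsUnit π) : RingHom.ker (fromB π n r) ≤
    quadIdeal (genericMatrix κ ε) (halfZ n r) revZ := by
  rw [← ker_rankOneHom_generic]
  refine ker_fromB_le_ker_rankOneHom hπ _ _ ?_
  rw [quadForm_generic, zero_mul]

theorem ker_fromB_le_quadIdeal_swap (hπ : ¬ IsUnit π) : RingHom.ker (fromB π n r) ≤
    quadIdeal (genericMatrix κ (swapEquiv ε)) (halfZc n r) revZc := by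
  rw [← ker_rankOneHom_generic, rankOneHom_swapEquiv]
  refine ker_fromB_le_ker_rankOneHom hπ _ _ ?_
  rw [quadForm_generic, mul_zero]

theorem quadIdeal_le_or_of_ker_fromB_le (hπ : ¬ IsUnit π) (h2 : (2 : κ) ≠ 0)
    {Q : Ideal (PolyB κ n r)} (hQ : Q.IsPrime) (h : RingHom.ker (fromB π n r) ≤ Q) :
    quadIdeal (genericMatrix κ ε) (halfZ n r) revZ ≤ Q ∨
      quadIdeal (genericMatrix κ (swapEquiv ε)) (halfZc n r) revZc ≤ Q := by
  refine quadIdeal_le_or_of_mul_mem ε hQ ?_ fun s t i j => h (fromB_quad_mul_quad hπ h2 i j s t)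
  rintro f ⟨i, t, j, s, rfl⟩
  exact h (fromB_minor hπ i t j s)

end Fiber

/-! ### The components of the special fiber -/

section Main

open MvPolynomial

variable {O : Type*} [CommRing O] [IsLocalRing O] {n r : ℕ} {π : O}

local notation "κ" => IsLocalRing.ResidueField O
local notation "ε" => Equiv.refl (Z n r × Zc n r)

/-- The case that one of the two quadrics splits into two hyperplanes. -/
theorem defineComponents_of_split (hs : Function.Surjective (fromB π n r)) {α β : Type*}
    [Finite α] [Finite β] [DecidableEq α] (e : α × β ≃ Z n r × Zc n r) {L : Finset α} {τ : α → α}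
    {L' : Finset β} {τ' : β → β} (hL : IsHalf L τ) (hL' : IsHalf L' τ') {a : α} (hLa : L = {a})
    (hα : ∀ i, i = a ∨ i = τ a) (hn : L'.Nontrivial) (hcα : Nat.card α = 2)
    (hcβ : Nat.card β = 2 * n - 2)
    (hrow : ∀ i, RingHom.ker (fromB π n r) ≤ rowIdeal κ e i)
    (hquad : RingHom.ker (fromB π n r) ≤ quadIdeal (genericMatrix κ (swapEquiv e)) L' τ')
    (hcover : ∀ Q : Ideal (PolyB κ n r), Q.IsPrime → RingHom.ker (fromB π n r) ≤ Q →
      quadIdeal (genericMatrix κ e) L τ ≤ Q ∨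
        quadIdeal (genericMatrix κ (swapEquiv e)) L' τ' ≤ Q) :
    DefineComponents π n r ![rowIdeal κ e a, rowIdeal κ e (τ a),
      quadIdeal (genericMatrix κ (swapEquiv e)) L' τ'] := by
  have hne : a ≠ τ a := (hL.apply_ne a).symm
  have hα' : ∀ i, i = τ a ∨ i = a := fun i => (hα i).symm
  obtain ⟨b, hb⟩ := hn.nonempty
  have haL : a ∈ L := by rw [hLa]; exact Finset.mem_singleton_self a
  have hq : ∀ i, i = a ∨ i = τ a → quadIdeal (genericMatrix κ e) L τ ≤ rowIdeal κ e i := by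
    rintro i (rfl | rfl)
    · exact quadIdeal_le_rowIdeal e hne hα (quadForm_two_rows hLa (Or.inl rfl) _)
    · exact quadIdeal_le_rowIdeal e hne.symm hα' (quadForm_two_rows hLa (Or.inr rfl) _)
  -- A row ideal contains the ideal of the split quadric, which is already not contained in that of
  -- the other quadric.
  have hnot : ∀ i, ¬ rowIdeal κ e i ≤ quadIdeal (genericMatrix κ (swapEquiv e)) L' τ' := fun i h =>
    not_quadIdeal_le_quadIdeal_swap e hL hL' haL b ((hq i (hα i)).trans h)
  have h01 := not_rowIdeal_le_rowIdeal (k := κ) e hne b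
  have h10 := not_rowIdeal_le_rowIdeal (k := κ) e hne.symm b
  have h20 := not_quadIdeal_swap_le_rowIdeal (k := κ) e hL' hb hne.symm
  have h21 := not_quadIdeal_swap_le_rowIdeal (k := κ) e hL' hb hne
  refine DefineComponents.of_prime_cover hs ?_ ?_ ?_ ?_ ?_
  · intro c
    fin_cases c
    exacts [hrow a, hrow (τ a), hquad]
  · intro c
    fin_cases c
    exacts [isPrime_of_two_rows e a (τ a) hne hα, isPrime_of_two_rows e (τ a) a hne.symm hα',
      isPrime_quadIdeal (swapEquiv e) L' τ' hL'.apply_notMem hL'.injOn hn]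
  · intro Q hQ hk
    rcases hcover Q hQ hk with h | h
    · rcases rowIdeal_le_or_of_quadIdeal_le e hLa hQ h with h | h
      · exact ⟨0, h⟩
      · exact ⟨1, h⟩
    · exact ⟨2, h⟩
  · intro c c' h
    fin_cases c <;> fin_cases c'
    exacts [rfl, (h01 h).elim, (hnot _ h).elim, (h10 h).elim, rfl, (hnot _ h).elim,
      (h20 h).elim, (h21 h).elim, rfl]
  · intro c
    fin_cases c
    · exact (ringKrullDim_quotient_of_two_rows e a (τ a) hne hα).trans (by rw [hcβ])
    · exact (ringKrullDim_quotient_of_two_rows e (τ a) a hne.symm hα').trans (by rw [hcβ])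
    · exact (ringKrullDim_quotient_quadIdeal (swapEquiv e) L' τ' hL'.apply_notMem hL'.injOn hn
        a).trans (by rw [hcβ, hcα, Nat.add_sub_cancel])

theorem halfZ_nontrivial (h : 2 ≤ r) (h' : r ≤ n) : (halfZ n r).Nontrivial := by
  refine ⟨⟨⟨n - 1, by omega⟩, mem_Z.2 ?_⟩, ?_, ⟨⟨n - 2, by omega⟩, mem_Z.2 ?_⟩, ?_, ?_⟩
  · simp only; omega
  · simp [halfZ]; omega
  · simp only; omega
  · simp [halfZ]; omega
  · simp; omega

theorem halfZc_nontrivial (h : r + 2 ≤ n) : (halfZc n r).Nontrivial := by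
  refine ⟨⟨⟨0, by omega⟩, mem_Zc.2 ?_⟩, ?_, ⟨⟨1, by omega⟩, mem_Zc.2 ?_⟩, ?_, ?_⟩
  · simp only; omega
  · simp [halfZc]; omega
  · simp only; omega
  · simp [halfZc]; omega
  · simp

theorem defineComponents_mid (hπ : ¬ IsUnit π) (h2 : (2 : κ) ≠ 0) (hr : 2 ≤ r) (hr' : r + 2 ≤ n) :
    DefineComponents π n r ![idealMid₁ κ n r, idealMid₂ κ n r] := by
  have hZ := isHalf_halfZ (n := n) (r := r)
  have hZc := isHalf_halfZc (n := n) (r := r)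
  have n1 := halfZ_nontrivial hr (by omega : r ≤ n)
  have n2 := halfZc_nontrivial hr'
  obtain ⟨a, ha⟩ := n1.nonempty
  obtain ⟨b, hb⟩ := n2.nonempty
  have h01 := not_quadIdeal_le_quadIdeal_swap (k := κ) ε hZ hZc ha b
  have h10 := not_quadIdeal_le_quadIdeal_swap (k := κ) (swapEquiv ε) hZc hZ hb a
  have c1 := card_Z (by omega : r ≤ n)
  have c2 := card_Zc (by omega : r ≤ n)
  have key : DefineComponents π n r ![quadIdeal (genericMatrix κ ε) (halfZ n r) revZ,
      quadIdeal (genericMatrix κ (swapEquiv ε)) (halfZc n r) revZc] := by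
    refine DefineComponents.of_prime_cover (fromB_surjective hπ h2) ?_ ?_ ?_ ?_ ?_
    · intro c
      fin_cases c
      exacts [ker_fromB_le_quadIdeal hπ, ker_fromB_le_quadIdeal_swap hπ]
    · intro c
      fin_cases c
      exacts [isPrime_quadIdeal _ _ _ hZ.apply_notMem hZ.injOn n1,
        isPrime_quadIdeal _ _ _ hZc.apply_notMem hZc.injOn n2]
    · intro Q hQ hk
      rcases quadIdeal_le_or_of_ker_fromB_le hπ h2 hQ hk with h | h
      · exact ⟨0, h⟩
      · exact ⟨1, h⟩
    · intro c c' h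
      fin_cases c <;> fin_cases c'
      exacts [rfl, (h01 h).elim, (h10 h).elim, rfl]
    · intro c
      fin_cases c
      · refine (ringKrullDim_quotient_quadIdeal ε _ _ hZ.apply_notMem hZ.injOn n1 b).trans ?_
        rw [c1, c2]
        congr 2
        omega
      · refine (ringKrullDim_quotient_quadIdeal (swapEquiv ε) _ _ hZc.apply_notMem hZc.injOn n2
          a).trans ?_
        rw [c1, c2]
        congr 2
        omega
  rw [← idealMid₁_eq, ← idealMid₂_eq] at key
  exact key

theorem defineComponents_low (hπ : ¬ IsUnit π) (h2 : (2 : κ) ≠ 0) (hn : 3 ≤ n) (hr : r = 1) :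
    DefineComponents π n r ![idealLow₁ κ n r, idealLow₂ κ n r, idealLow₃ κ n r] := by
  have hm : (⟨n - 1, by omega⟩ : Fin (2 * n)) ∈ Z n r := by rw [mem_Z]; simp only; omega
  let a : Z n r := ⟨⟨n - 1, by omega⟩, hm⟩
  have hτ : ((revZ a).1 : ℕ) = n := by simp only [revZ, a, Fin.val_rev]; omega
  have hα : ∀ i : Z n r, i = a ∨ i = revZ a := by
    intro i
    have := mem_Z.1 i.2
    have h : (i.1 : ℕ) = n - 1 ∨ (i.1 : ℕ) = n := by omega
    refine h.imp (fun h => Subtype.ext (Fin.ext h)) fun h => Subtype.ext (Fin.ext ?_)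
    rw [h, hτ]
  have hne : a ≠ revZ a := (isHalf_halfZ.apply_ne a).symm
  have hL : halfZ n r = {a} := by
    ext i
    rw [Finset.mem_singleton]
    constructor
    · intro h
      refine (hα i).resolve_right fun h' => ?_
      have := (Finset.mem_filter.1 h).2
      rw [h', hτ] at this
      omega
    · rintro rfl
      refine Finset.mem_filter.2 ⟨Finset.mem_univ _, ?_⟩
      change n - 1 < n
      omega
  have key := defineComponents_of_split (fromB_surjective (n := n) (r := r) hπ h2) ε isHalf_halfZ
    isHalf_halfZc hL hα (halfZc_nontrivial (by omega)) (by rw [card_Z (by omega), hr])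
    (by rw [card_Zc (by omega), hr]) ?_ (ker_fromB_le_quadIdeal_swap hπ)
    fun Q hQ h => quadIdeal_le_or_of_ker_fromB_le hπ h2 hQ h
  · rw [← idealLow₁_eq κ a (by change n - 1 + 1 = n; omega), ← idealLow₂_eq κ (revZ a) hτ,
      ← idealLow₃_eq] at key
    exact key
  · intro i
    rcases hα i with rfl | rfl
    · rw [rowIdeal, ← ker_rankOneHom_of_two_rows ε a (revZ a) hne hα]
      refine ker_fromB_le_ker_rankOneHom hπ _ _ ?_
      rw [quadForm_two_rows hL (Or.inl rfl), zero_mul]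
    · rw [rowIdeal, ← ker_rankOneHom_of_two_rows ε (revZ a) a hne.symm fun i => (hα i).symm]
      refine ker_fromB_le_ker_rankOneHom hπ _ _ ?_
      rw [quadForm_two_rows hL (Or.inr rfl), zero_mul]

theorem defineComponents_high (hπ : ¬ IsUnit π) (h2 : (2 : κ) ≠ 0) (hn : 3 ≤ n)
    (hr : r + 1 = n) :
    DefineComponents π n r ![idealHigh₁ κ n r, idealHigh₂ κ n r, idealHigh₃ κ n r] := by
  have hm : (⟨0, by omega⟩ : Fin (2 * n)) ∈ Zc n r := by rw [mem_Zc]; simp only; omega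
  let a : Zc n r := ⟨⟨0, by omega⟩, hm⟩
  have hτ : ((revZc a).1 : ℕ) + 1 = 2 * n := by simp only [revZc, a, Fin.val_rev]; omega
  have hα : ∀ i : Zc n r, i = a ∨ i = revZc a := by
    intro i
    have := mem_Zc.1 i.2
    have h : (i.1 : ℕ) = 0 ∨ (i.1 : ℕ) + 1 = 2 * n := by omega
    refine h.imp (fun h => Subtype.ext (Fin.ext h)) fun h => Subtype.ext (Fin.ext ?_)
    omega
  have hne : a ≠ revZc a := (isHalf_halfZc.apply_ne a).symm
  have hL : halfZc n r = {a} := by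
    ext i
    rw [Finset.mem_singleton]
    constructor
    · intro h
      refine (hα i).resolve_right fun h' => ?_
      have := (Finset.mem_filter.1 h).2
      rw [h'] at this
      omega
    · rintro rfl
      refine Finset.mem_filter.2 ⟨Finset.mem_univ _, ?_⟩
      change 0 < n
      omega
  have hε : swapEquiv (swapEquiv ε) = ε := rfl
  -- Transposition exchanges q and q', so here the two split "rows" are the columns 1 and d of B.
  have key := defineComponents_of_split (fromB_surjective (n := n) (r := r) hπ h2) (swapEquiv ε)
    isHalf_halfZc isHalf_halfZ hL hα (halfZ_nontrivial (by omega) (by omega))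
    (by rw [card_Zc (by omega)]; omega) (by rw [card_Z (by omega)]; omega) ?_
    (ker_fromB_le_quadIdeal hπ)
    fun Q hQ h => (quadIdeal_le_or_of_ker_fromB_le hπ h2 hQ h).symm
  · rw [hε, ← idealHigh₁_eq κ a rfl, ← idealHigh₂_eq κ (revZc a) hτ, ← idealHigh₃_eq] at key
    exact key
  · intro i
    rcases hα i with rfl | rfl
    · rw [rowIdeal, ← ker_rankOneHom_of_two_rows (swapEquiv ε) a (revZc a) hne hα,
        rankOneHom_swapEquiv]
      refine ker_fromB_le_ker_rankOneHom hπ _ _ ?_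
      rw [quadForm_two_rows hL (Or.inl rfl), mul_zero]
    · rw [rowIdeal, ← ker_rankOneHom_of_two_rows (swapEquiv ε) (revZc a) a hne.symm
        fun i => (hα i).symm, rankOneHom_swapEquiv]
      refine ker_fromB_le_ker_rankOneHom hπ _ _ ?_
      rw [quadForm_two_rows hL (Or.inr rfl), mul_zero]

end Main

end OrthogonalChart

end

theorem theorem7p1 {O : Type*} [CommRing O] [IsDomain O] [IsDiscreteValuationRing O]
    (h2 : ringChar (IsLocalRing.ResidueField O) ≠ 2) (π : O) (hπ : Irreducible π)
    (n r : ℕ) (hd : 5 ≤ 2 * n) (hl : 1 < 2 * r) (hl' : 2 * r + 1 < 2 * n) :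
    (r = 1 ∨ r = n - 1 →
      (irreducibleComponents (OrthogonalChart.SpecialFiber π n r)).ncard = 3) ∧
    (1 < r ∧ r < n - 1 →
      (irreducibleComponents (OrthogonalChart.SpecialFiber π n r)).ncard = 2) ∧
    (r = 1 → OrthogonalChart.DefineComponents π n r
      ![OrthogonalChart.idealLow₁ _ n r, OrthogonalChart.idealLow₂ _ n r,
        OrthogonalChart.idealLow₃ _ n r]) ∧
    (r = n - 1 → OrthogonalChart.DefineComponents π n r
      ![OrthogonalChart.idealHigh₁ _ n r, OrthogonalChart.idealHigh₂ _ n r,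
        OrthogonalChart.idealHigh₃ _ n r]) ∧
    (1 < r ∧ r < n - 1 → OrthogonalChart.DefineComponents π n r
      ![OrthogonalChart.idealMid₁ _ n r, OrthogonalChart.idealMid₂ _ n r]) := by
  have h2' : (2 : IsLocalRing.ResidueField O) ≠ 0 := Ring.two_ne_zero h2
  have hu : ¬ IsUnit π := hπ.not_isUnit
  have low (h : r = 1) := OrthogonalChart.defineComponents_low (n := n) hu h2' (by omega) h
  have high (h : r = n - 1) := OrthogonalChart.defineComponents_high (n := n) (r := r) hu h2'
    (by omega) (by omega)
  have mid (h : 1 < r ∧ r < n - 1) := OrthogonalChart.defineComponents_mid (n := n) (r := r) hu h2'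
    (by omega) (by omega)
  exact ⟨fun h => h.elim (fun h => (low h).ncard) fun h => (high h).ncard, fun h => (mid h).ncard,
    low, high, mid⟩
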